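/- Let $Q$ be a finite-dimensional smooth ($\mathrm C^\infty$, Hausdorff, second countable) manifold and $k\in\mathbb N$. Let $\mathrm T^1_kQ=\mathrm TQ\oplus_Q\overset{k}{\cdots}\oplus_Q\mathrm TQ$, with projection $\pi$ onto $Q$ and points $x=(q;v_1,\dots,v_k)$, and let $(\mathrm T^1_k)^*Q$ be the Whitney sum of $k$ copies of $\mathrm T^*Q$. For $u\in\mathrm T_qQ$ let $u^{\wedge\alpha}_x=\frac{d}{dt}\big|_{0}(q;v_1,\dots,v_\alpha+tu,\dots,v_k)$; let $J^\alpha(U)=(\mathrm T\pi(U))^{\wedge\alpha}$ for tangent vectors $U$ of $\mathrm T^1_kQ$, and $\Delta_x=\sum_\alpha (v_\alpha)^{\wedge\alpha}_x$. Let $\mathcal L\in \mathrm C^\infty(\mathrm T^1_kQ)$, $\omega^\alpha_{\mathcal L}=-\mathrm d(\mathrm d\mathcal L\circ J^\alpha)$, $\mathcal E_{\mathcal L}=\Delta(\mathcal L)-\mathcal L$, and $\mathbf\Omega_{\mathcal L}(\mathbf Y)=\sum_{\alpha}i(Y_\alpha)\omega^\alpha_{\mathcal L}$ for a $k$-vector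 field (or, at one point, a $k$-tuple of tangent vectors) $\mathbf Y=(Y_1,\dots,Y_k)$ on $\mathrm T^1_kQ$. The Legendre map $\mathcal{FL}:\mathrm T^1_kQ\to(\mathrm T^1_k)^*Q$ sends $(q;v_1,\dots,v_k)$ to $(q;p^1,\dots,p^k)$ with $p^\alpha(u)=\frac{d}{ds}\big|_0\mathcal L(q;v_1,\dots,v_\alpha+su,\dots,v_k)$. Assume that $\mathcal L$ is almost-regular: $\mathcal{FL}(\mathrm T^1_kQ)$ is a closed submanifold of $(\mathrm T^1_k)^*Q$, $\mathcal{FL}$ is a submersion onto it, and the fibres of $\mathcal{FL}$ are connected. For a set $\mathfrak S$ of smooth $k$-vector fields on $\mathrm T^1_kQ$, let $\mathfrak S^\perp$ be the set of smooth vector fields $Z$ such that $\mathbf\Omega_{\mathcal L}(\mathbf Y)(Z)=0$ for every $\mathbf Y\in\mathfrak S$. Let $\mathfrak X^k$ be the set of all smooth $k$-vector fields, $\mathfrak X^{kV}$ the subset of those that are $\pi$-vertical, and $\mathfrak M=[\mathfrak X^{kV}]^\perp$. Let $$P_1=\{x\in\mathrm T^1_kQ:\ (\mathrm d\mathcal E_{\mathcal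 L})_x\in\operatorname{Im}(\mathbf\Omega_{\mathcal L})_x\},$$ let $\mathbf X$ be a $k$-vector field with $\mathbf\Omega_{\mathcal L}(\mathbf X)=\mathrm d\mathcal E_{\mathcal L}$ on $P_1$, and let $$S_1=\Big\{x\in P_1:\ \exists\,\mathbf Y\in\ker(\mathbf\Omega_{\mathcal L})_x,\ \sum_\alpha J^\alpha(X_\alpha(x)+Y_\alpha)=\Delta_x\Big\}.$$ Let $\mathbf\Gamma$ be a second-order $k$-vector field (SOPDE), i.e. $\mathrm T\pi(\Gamma_\alpha(x))=v_\alpha$ for all $\alpha$ and all $x=(q;v_1,\dots,v_k)$. (Smoothness of $\mathbf X$ and $\mathbf\Gamma$ is not needed.) For $Z\in\mathfrak M\setminus[\mathfrak X^k]^\perp$ put $\eta_1^{(Z)}=i(Z)\mathbf\Omega_{\mathcal L}(\mathbf\Gamma-\mathbf X)$. A function on $P_1$ is called $\mathcal{FL}$-projectable if it is of the form $g\circ\mathcal{FL}|_{P_1}$ for some (not necessarily smooth) function $g$; a vector field $Z$ on $\mathrm T^1_kQ$ is called $\mathcal{FL}$-projectable if $\mathrm T\mathcal{FL}(Z_x)$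 depends only on $\mathcal{FL}(x)$. Then: 1. Nontrivial first-generation SOPDE (non-dynamical) constraints are not $\mathcal{FL}$-projectable: if $Z\in\mathfrak M\setminus[\mathfrak X^k]^\perp$ and $\eta_1^{(Z)}$ does not vanish identically on $P_1$, then $\eta_1^{(Z)}|_{P_1}$ is not $\mathcal{FL}$-projectable. 2. If $Z\in\mathfrak M\setminus[\mathfrak X^k]^\perp$ is an $\mathcal{FL}$-projectable vector field and $x\in P_1$ is a point at which $Z_x$ is not the sum of a vector of $\bigcap_\alpha\ker(\omega^\alpha_{\mathcal L})_x$ and a $\pi$-vertical vector, then there is a vertical vector in $\ker\mathrm T_x\mathcal{FL}$, given by $w=(w_1,\dots,w_k)\in(\mathrm T_qQ)^k$ with $x=(q;v)$, such that the derivative $\frac{d}{dt}\big|_0\,\eta_1^{(Z)}(q;v+tw)$ exists and is nonzero; and $\eta_1^{(Z)}|_{P_1}$ is not $\mathcal{FL}$-projectable. 3. $\mathcal{FL}(P_1)=\mathcal{FL}(S_1)$. -/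

import Mathlib

open Bundle Set
open scoped Manifold ContDiff Topology

noncomputable section

namespace KSymplectic

/-! ### Calculus on manifolds -/

section Manifolds

variable {V : Type*} [NormedAddCommGroup V] [NormedSpace ℝ V] {H : Type*} [TopologicalSpace H]
  (I : ModelWithCorners ℝ V H) {M : Type*} [TopologicalSpace M] [ChartedSpace H M]
  [IsManifold I ∞ M]

/-- The exterior derivative of a `1`-form `θ` on a manifold without boundary, evaluated at `x` on
two tangent vectors. The form is pulled back to the model space by the inverse of the chart `φ` at
`x`, and `dθ(u, w) = ∂_u (θ w) - ∂_w (θ u)`, where `u`, `w` are extended with constant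
coefficients. (The differential at `x` of the preferred chart at `x` is the identity of
`TangentSpace I x = V`.) -/
def dOneForm (θ : ∀ x : M, TangentSpace I x →L[ℝ] ℝ) (x : M) (u w : TangentSpace I x) : ℝ :=
  let φ := extChartAt I x
  let θφ : V → V →L[ℝ] ℝ := fun y => (θ (φ.symm y)).comp (mfderiv 𝓘(ℝ, V) I φ.symm y)
  fderiv ℝ θφ (φ x) u w - fderiv ℝ θφ (φ x) w u

/-- A smooth vector field on `M`. -/
def IsSmoothVectorField (Z : ∀ x : M, TangentSpace I x) : Prop :=
  ContMDiff I I.tangent ∞ (fun x => (⟨x, Z x⟩ : TangentBundle I M))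

/-- `(Φ, K)` is a slice chart of `S` around `p`: in the smooth chart `Φ` around `p`, the set `S` is
the linear subspace `K`. -/
def IsSliceChart (S : Set M) (p : M) (Φ : OpenPartialHomeomorph M H) (K : Submodule ℝ V) : Prop :=
  Φ ∈ IsManifold.maximalAtlas I ∞ M ∧ p ∈ Φ.source ∧ ∀ y ∈ Φ.source, y ∈ S ↔ Φ.extend I y ∈ K

/-- `S` is a closed (embedded) submanifold of `M`. -/
def IsClosedSubmanifold (S : Set M) : Prop :=
  IsClosed S ∧ ∀ p ∈ S, ∃ (Φ : OpenPartialHomeomorph M H) (K : Submodule ℝ V),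
    IsSliceChart I S p Φ K

variable {V' : Type*} [NormedAddCommGroup V'] [NormedSpace ℝ V'] {H' : Type*} [TopologicalSpace H']
  (I' : ModelWithCorners ℝ V' H') {M' : Type*} [TopologicalSpace M'] [ChartedSpace H' M']

/-- The smooth map `f : M' → M`, whose image is a submanifold of `M`, is a submersion onto its
image: at every `x`, its differential maps onto the tangent space of the image, which in a
slice chart `(Φ, K)` of the image is `K`. -/
def IsSubmersionOntoImage (f : M' → M) : Prop :=
  ∀ (x : M') (Φ : OpenPartialHomeomorph M H) (K : Submodule ℝ V),
    IsSliceChart I (range f) (f x) Φ K →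
      ∀ c ∈ K, ∃ u : TangentSpace I' x, mfderiv I' 𝓘(ℝ, V) (Φ.extend I ∘ f) x u = c

end Manifolds

/-! ### The `k`-tangent and `k`-cotangent bundles -/

section Bundles

variable (E : Type*) [NormedAddCommGroup E] [NormedSpace ℝ E]
  (Q : Type*) [TopologicalSpace Q] [ChartedSpace E Q] [IsManifold 𝓘(ℝ, E) ∞ Q] (k : ℕ)

/-- The `k`-tangent bundle `T¹ₖQ = TQ ⊕ ⋯ ⊕ TQ`, as the bundle `Hom(ℝᵏ, TQ)`: the linear map
`v : ℝᵏ → T_q Q` stands for the `k` tangent vectors `v_α = v e_α`. -/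
abbrev TkQ : Type _ :=
  TotalSpace ((Fin k → ℝ) →L[ℝ] E)
    (fun q : Q => Trivial Q (Fin k → ℝ) q →L[ℝ] TangentSpace 𝓘(ℝ, E) q)

/-- The `k`-cotangent bundle `(T¹ₖ)*Q = T*Q ⊕ ⋯ ⊕ T*Q`, as the bundle `Hom(TQ, ℝᵏ)`: the linear
map `p : T_q Q → ℝᵏ` stands for the `k` covectors `p^α = (p ·)_α`. -/
abbrev TkStarQ : Type _ :=
  TotalSpace (E →L[ℝ] (Fin k → ℝ))
    (fun q : Q => TangentSpace 𝓘(ℝ, E) q →L[ℝ] Trivial Q (Fin k → ℝ) q)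

/-- The model with corners (without boundary) of `T¹ₖQ`. -/
abbrev IT : ModelWithCorners ℝ (E × ((Fin k → ℝ) →L[ℝ] E)) (ModelProd E ((Fin k → ℝ) →L[ℝ] E)) :=
  𝓘(ℝ, E).prod 𝓘(ℝ, (Fin k → ℝ) →L[ℝ] E)

/-- The model with corners (without boundary) of `(T¹ₖ)*Q`. -/
abbrev ITStar :
    ModelWithCorners ℝ (E × (E →L[ℝ] (Fin k → ℝ))) (ModelProd E (E →L[ℝ] (Fin k → ℝ))) :=
  𝓘(ℝ, E).prod 𝓘(ℝ, E →L[ℝ] (Fin k → ℝ))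

end Bundles

variable {E : Type*} [NormedAddCommGroup E] [NormedSpace ℝ E]
  {Q : Type*} [TopologicalSpace Q] [ChartedSpace E Q] [IsManifold 𝓘(ℝ, E) ∞ Q] {k : ℕ}

/-- The tangent space of `T¹ₖQ` at `x`. -/
abbrev TT (x : TkQ E Q k) : Type _ := TangentSpace (IT E k) x

/-- The point `(q; v)` of `T¹ₖQ` over `q`. The tangent space `T_q Q` is the vector space `E`. -/
def inFibre (q : Q) (v : (Fin k → ℝ) →L[ℝ] E) : TkQ E Q k := ⟨q, v⟩

/-- The element `v` of `Hom(ℝᵏ, T_q Q)`, for `x = (q; v)`. -/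
def vel (x : TkQ E Q k) : (Fin k → ℝ) →L[ℝ] E := x.snd

/-- The differential of the projection `π : T¹ₖQ → Q`. -/
def dProj (x : TkQ E Q k) : TT x →L[ℝ] TangentSpace 𝓘(ℝ, E) x.proj :=
  mfderiv (IT E k) 𝓘(ℝ, E) (TotalSpace.proj : TkQ E Q k → Q) x

/-- `(T_q Q)ᵏ → T_x(T¹ₖQ)`, `w ↦ d/dt|₀ (q; v + t w)`, for `x = (q; v)`. -/
def vertical (x : TkQ E Q k) : ((Fin k → ℝ) →L[ℝ] E) →L[ℝ] TT x :=
  mfderiv 𝓘(ℝ, (Fin k → ℝ) →L[ℝ] E) (IT E k) (inFibre x.proj) (vel x)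

/-- `T_q Q → (T_q Q)ᵏ`, `u ↦ (0, …, u, …, 0)`, with `u` in the place `α`. -/
def single (α : Fin k) : E →L[ℝ] ((Fin k → ℝ) →L[ℝ] E) :=
  ContinuousLinearMap.smulRightL ℝ (Fin k → ℝ) E (ContinuousLinearMap.proj α)

/-- The vertical `α`-lift `T_q Q → T_x(T¹ₖQ)`. -/
def vLift (α : Fin k) (x : TkQ E Q k) : TangentSpace 𝓘(ℝ, E) x.proj →L[ℝ] TT x :=
  (vertical x).comp (single (E := E) α)

/-- The component `v_α ∈ T_q Q` of the point `x = (q; v_1, …, v_k)`. -/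
def velocity (α : Fin k) (x : TkQ E Q k) : TangentSpace 𝓘(ℝ, E) x.proj :=
  vel x (Pi.single α 1)

/-- The vertical endomorphism `J^α`. -/
def J (α : Fin k) (x : TkQ E Q k) : TT x →L[ℝ] TT x :=
  (vLift α x).comp (dProj x)

/-- The Liouville vector field `Δ`. -/
def liouville (x : TkQ E Q k) : TT x := ∑ α, vLift α x (velocity α x)

/-- A vector field on `T¹ₖQ` (smoothness is a separate condition). -/
abbrev VF (E Q : Type*) [NormedAddCommGroup E] [NormedSpace ℝ E] [TopologicalSpace Q]
    [ChartedSpace E Q] [IsManifold 𝓘(ℝ, E) ∞ Q] (k : ℕ) : Type _ := ∀ x : TkQ E Q k, TT x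

/-- A `k`-vector field `(X_1, …, X_k)` on `T¹ₖQ` (smoothness is a separate condition). -/
abbrev KVF (E Q : Type*) [NormedAddCommGroup E] [NormedSpace ℝ E] [TopologicalSpace Q]
    [ChartedSpace E Q] [IsManifold 𝓘(ℝ, E) ∞ Q] (k : ℕ) : Type _ := Fin k → VF E Q k

/-- `𝔛ᵏ(T¹ₖQ)`, the smooth `k`-vector fields. -/
def smoothKVF (E Q : Type*) [NormedAddCommGroup E] [NormedSpace ℝ E] [TopologicalSpace Q]
    [ChartedSpace E Q] [IsManifold 𝓘(ℝ, E) ∞ Q] (k : ℕ) : Set (KVF E Q k) :=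
  {Y | ∀ α, IsSmoothVectorField (IT E k) (Y α)}

/-- `𝔛ᵏⱽ(T¹ₖQ)`, the smooth `k`-vector fields which are vertical for `π`. -/
def smoothVerticalKVF (E Q : Type*) [NormedAddCommGroup E] [NormedSpace ℝ E] [TopologicalSpace Q]
    [ChartedSpace E Q] [IsManifold 𝓘(ℝ, E) ∞ Q] (k : ℕ) : Set (KVF E Q k) :=
  {Y | Y ∈ smoothKVF E Q k ∧ ∀ α x, dProj x (Y α x) = 0}

/-- The second-order condition for a `k`-vector field `Γ` on `T¹ₖQ`: it is a section of
`T¹ₖπ : T¹ₖ(T¹ₖQ) → T¹ₖQ`, that is, `Tπ(Γ_α(x)) = v_α` for `x = (q; v_1, …, v_k)`. -/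
def IsSOPDE (Γ : KVF E Q k) : Prop := ∀ α x, dProj x (Γ α x) = velocity α x

/-! ### Lagrangian formalism -/

variable (L : TkQ E Q k → ℝ)

/-- The differential of a function on `T¹ₖQ`. -/
def dFun (f : TkQ E Q k → ℝ) (x : TkQ E Q k) : TT x →L[ℝ] ℝ := mfderiv (IT E k) 𝓘(ℝ, ℝ) f x

/-- The Cartan `1`-forms `θ^α_L = dL ∘ J^α`. -/
def cartanOne (α : Fin k) (x : TkQ E Q k) : TT x →L[ℝ] ℝ := (dFun L x).comp (J α x)

/-- The Cartan `2`-forms `ω^α_L = -dθ^α_L`. -/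
def cartanTwo (α : Fin k) (x : TkQ E Q k) (u w : TT x) : ℝ :=
  - dOneForm (IT E k) (cartanOne L α) x u w

/-- The Lagrangian energy `E_L = Δ(L) - L`. -/
def energy (x : TkQ E Q k) : ℝ := dFun L x (liouville x) - L x

/-- `Ω_L(Y) = ∑_α i(Y_α) ω^α_L` at the point `x`, evaluated on a tangent vector `z`. -/
def Omega (x : TkQ E Q k) (Y : Fin k → TT x) (z : TT x) : ℝ := ∑ α, cartanTwo L α x (Y α) z

/-- The Legendre transformation: `FL(q; v)^α (u) = d/ds|₀ L(q; v_1, …, v_α + s u, …, v_k)`. -/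
def legendre (x : TkQ E Q k) : TkStarQ E Q k :=
  ⟨x.proj, ContinuousLinearMap.pi fun α =>
    (fderiv ℝ (fun v : (Fin k → ℝ) →L[ℝ] E => L (inFibre x.proj v)) (vel x)).comp (single (E := E) α)⟩

/-- The differential of the Legendre transformation. -/
def dLegendre (x : TkQ E Q k) : TT x →L[ℝ] TangentSpace (ITStar E k) (legendre L x) :=
  mfderiv (IT E k) (ITStar E k) (legendre L) x

/-- Almost-regular Lagrangians. (The fibres of `FL` are then automatically submanifolds.) -/
def IsAlmostRegular : Prop :=
  IsClosedSubmanifold (ITStar E k) (range (legendre L)) ∧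
  IsSubmersionOntoImage (ITStar E k) (IT E k) (legendre L) ∧
  ∀ p ∈ range (legendre L), IsConnected (legendre L ⁻¹' {p})

/-- The annihilator `𝔖^⊥` of a set of `k`-vector fields, with respect to `Ω_L`. -/
def annihilator (S : Set (KVF E Q k)) : Set (VF E Q k) :=
  {Z | IsSmoothVectorField (IT E k) Z ∧ ∀ Y ∈ S, ∀ x, Omega L x (fun α => Y α x) (Z x) = 0}

/-- `𝔐 = [𝔛ᵏⱽ(T¹ₖQ)]^⊥`. -/
def frakM : Set (VF E Q k) := annihilator L (smoothVerticalKVF E Q k)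

/-- The set `P_1` of the points where the Lagrangian equation `Ω_L(X) = dE_L` has a solution. -/
def P1 : Set (TkQ E Q k) :=
  {x | ∃ Y : Fin k → TT x, ∀ z, Omega L x Y z = dFun (energy L) x z}

/-- `X` is a solution of the Lagrangian equation on the set `S`. -/
def IsLagrangianOn (X : KVF E Q k) (S : Set (TkQ E Q k)) : Prop :=
  ∀ x ∈ S, ∀ z, Omega L x (fun α => X α x) z = dFun (energy L) x z

/-- `S_1`: the points of `P_1` where the solution `X` can be turned into a solution satisfying the
second-order condition, by adding an element of the kernel of `Ω_L`. -/
def S1 (X : KVF E Q k) : Set (TkQ E Q k) :=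
  {x | x ∈ P1 L ∧ ∃ Y : Fin k → TT x,
    (∀ z, Omega L x Y z = 0) ∧ ∑ α, J α x (X α x + Y α) = liouville x}

/-- The functions `η^(Z) = i(Z) Ω_L(Γ - X)`. -/
def eta (Γ X : KVF E Q k) (Z : VF E Q k) (x : TkQ E Q k) : ℝ :=
  Omega L x (fun α => Γ α x - X α x) (Z x)

/-- The function `f`, on the set `S`, is `FL`-projectable: it is the pull-back of a function by
`FL`. No smoothness is asked for, so that failure of this condition is a strong statement. -/
def IsProjectableOn (S : Set (TkQ E Q k)) (f : TkQ E Q k → ℝ) : Prop :=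
  ∃ g : TkStarQ E Q k → ℝ, ∀ x ∈ S, f x = g (legendre L x)

/-- The vector field `Z` is `FL`-projectable: it is `FL`-related with a vector field along the
image of `FL`. -/
def IsProjectableVF (Z : VF E Q k) : Prop :=
  ∃ Z₀ : ∀ p : TkStarQ E Q k, TangentSpace (ITStar E k) p,
    ∀ x, dLegendre L x (Z x) = Z₀ (legendre L x)

/-- The sum, in `T_x(T¹ₖQ)`, of `⋂_α ker (ω^α_L)_x = {a | Ω_L(Y)(a) = 0 for all Y}` and of the
space of vertical vectors. -/
def kerPlusVertical (x : TkQ E Q k) : Set (TT x) :=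
  {z | ∃ a b : TT x, (∀ Y : Fin k → TT x, Omega L x Y a = 0) ∧ dProj x b = 0 ∧ z = a + b}

end KSymplectic

end

/-! Over a fixed `q`, the Legendre map becomes the map `fibreP` from `(T_qQ)ᵏ` to `(T*_qQ)ᵏ`. Let
`F` be the level set of `fibreP` through a point of `P_1`. In coordinates `ω^α_L` depends on its
arguments only through their base components and their images under the differential of `FL`. The
same is true of the differential of the energy along `F`; this is where connectedness of the fibres
enters (`dFun_energy_eq`). Almost-regularity makes the image of `TFL` the same at all points of `F`
(`exists_same_dLegendre`). Hence a solution at one point of `F` gives solutions at all of them, with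
the same base components `u = (u_1, …, u_k)` (`exists_solution_of_fibreP_eq`).

On vertical vectors the Lagrangian equation at `b ∈ F` says that `u - b` is in the kernel of the
fibre Hessian of `L`, that is, tangent to `F`. So the Euler field `b ↦ u - b` is tangent to the
closed set `F`, which is therefore a cone with vertex `u ∈ F` (`ray_mem_level`). A cone which is a
submanifold through its vertex is affine (`add_mem_level`). `exists_centre` collects these facts.

At the centre `u` there is a solution which satisfies the second-order condition, whence item 3.
There `Γ` and this solution have the same base components, the only ones that a field of `𝔐`
detects, so every `η^(Z)` vanishes at the centre; a projectable `η^(Z)` then vanishes on the whole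
of `F`, whence item 1. If `Z` is projectable, `η^(Z)` is affine along `F` with linear part
`linPart`. By duality for the symmetric Hessian, `linPart` vanishes on the tangent directions of `F`
only if `Z_x` lies in `kerPlusVertical`; otherwise `η^(Z)` is not constant on some line of `F`,
whence item 2. -/

noncomputable section

namespace KSymplectic

/-! ### Local retractions onto level sets, from the implicit function theorem. -/

section Retraction

open Filter

/-- Near `x₀`, the level set of a map `G` which is a submersion onto its image is a retract of its
neighbourhoods, by a `C¹` retraction which moves the points by at most a multiple of
`‖G x - G x₀‖`. -/
theorem exists_retraction {X Y Y' : Type*} [NormedAddCommGroup X] [NormedSpace ℝ X]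
    [CompleteSpace X] [NormedAddCommGroup Y] [NormedSpace ℝ Y]
    [NormedAddCommGroup Y'] [NormedSpace ℝ Y'] [FiniteDimensional ℝ Y'] {G : X → Y} {ψ : Y → Y'}
    {x₀ : X} (hG : ContDiffAt ℝ 1 G x₀) (hψ : ContDiffAt ℝ 1 ψ (G x₀))
    {N : Set Y} (hN : N ∈ 𝓝 (G x₀)) (hinj : InjOn ψ N) (K : Submodule ℝ Y')
    (hK : ∀ᶠ x in 𝓝 x₀, ψ (G x) ∈ K) (hsurj : ∀ c ∈ K, ∃ u, fderiv ℝ (ψ ∘ G) x₀ u = c) :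
    ∃ r : X → X, ContDiffAt ℝ 1 r x₀ ∧ (∀ᶠ x in 𝓝 x₀, G (r x) = G x₀) ∧
      (∀ᶠ x in 𝓝 x₀, G x = G x₀ → r x = x) ∧
      ∃ C : ℝ, ∀ᶠ x in 𝓝 x₀, ‖r x - x‖ ≤ C * ‖G x - G x₀‖ := by
  -- Composing with a projection onto `K` gives a map `g` into `K` whose differential is onto, to
  -- which the implicit function theorem applies. Nothing is lost, because `ψ ∘ G` takes values in
  -- `K` near `x₀`.
  obtain ⟨pr, hpr⟩ := Submodule.ClosedComplemented.of_finiteDimensional (𝕜 := ℝ) K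
  have hψG : ContDiffAt ℝ 1 (ψ ∘ G) x₀ := hψ.comp x₀ hG
  set g : X → K := fun x => pr (ψ (G x)) with hg
  have hgC : ContDiffAt ℝ 1 g x₀ := pr.contDiff.contDiffAt.comp x₀ hψG
  have hgd : HasStrictFDerivAt g (pr.comp (fderiv ℝ (ψ ∘ G) x₀)) x₀ :=
    pr.hasStrictFDerivAt.comp x₀ (hψG.hasStrictFDerivAt one_ne_zero)
  have hgs : (pr.comp (fderiv ℝ (ψ ∘ G) x₀)).range = ⊤ := by
    rw [LinearMap.range_eq_top]
    intro c
    obtain ⟨u, hu⟩ := hsurj c c.2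
    refine ⟨u, ?_⟩
    change pr (fderiv ℝ (ψ ∘ G) x₀ u) = c
    rw [hu, hpr]
  set φ := HasStrictFDerivAt.implicitFunctionDataOfComplemented g _ hgd hgs
    (pr.comp (fderiv ℝ (ψ ∘ G) x₀)).ker_closedComplemented_of_finiteDimensional_range with hφ
  have hpt : φ.pt = x₀ := rfl
  have hl : φ.leftFun = g := rfl
  have hlC : ContDiffAt ℝ 1 φ.leftFun φ.pt := hgC
  have hrC : ContDiffAt ℝ 1 φ.rightFun φ.pt :=
    (ContinuousLinearMap.contDiff _).contDiffAt.comp _ (contDiffAt_id.sub contDiffAt_const)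
  have hθ := ImplicitFunctionData.contDiffAt_implicitFunction hlC hrC one_ne_zero
  -- The retraction keeps the kernel coordinate `φ.rightFun` of `x` and resets the value of `g` to
  -- that at `x₀`.
  have hr : ContDiffAt ℝ 1
      (fun x => φ.implicitFunction.uncurry (φ.leftFun x₀, φ.rightFun x)) x₀ :=
    ContDiffAt.comp (f := fun x => (φ.leftFun x₀, φ.rightFun x)) x₀ hθ
      (contDiffAt_const.prodMk hrC)
  have happ := φ.implicitFunction_apply_image
  have hleft := φ.leftFun_implicitFunction_eq_leftFun
  rw [hpt] at happ hleft
  have hr0 : φ.implicitFunction.uncurry (φ.leftFun x₀, φ.rightFun x₀) = x₀ := happ.self_of_nhds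
  have htend : Tendsto (fun x => φ.implicitFunction.uncurry (φ.leftFun x₀, φ.rightFun x))
      (𝓝 x₀) (𝓝 x₀) := by
    have := hr.continuousAt.tendsto
    rwa [hr0] at this
  refine ⟨_, hr, ?_, ?_, ?_⟩
  · have hNx : ∀ᶠ x in 𝓝 x₀, G x ∈ N := hG.continuousAt.eventually hN
    filter_upwards [htend.eventually hNx, htend.eventually hK, hleft] with x h1 h2 h3
    refine hinj h1 (mem_of_mem_nhds hN) ?_
    have h4 : (pr (ψ (G (φ.implicitFunction.uncurry (φ.leftFun x₀, φ.rightFun x)))) : Y') =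
        pr (ψ (G x₀)) := congrArg _ h3
    have h5 := hpr ⟨_, h2⟩
    have h6 := hpr ⟨_, hK.self_of_nhds⟩
    simp only at h5 h6
    rwa [h5, h6] at h4
  · filter_upwards [happ] with x hx h
    have : φ.leftFun x = φ.leftFun x₀ := by simp only [hl, hg, h]
    rw [← this]
    exact hx
  -- Both `x` and `r x` are values of the implicit function, at arguments which differ only by `g x
  -- - g x₀`; Lipschitz bounds for this function and for `ψ` give the estimate.
  · obtain ⟨C₁, s, hs, hlip⟩ := hθ.exists_lipschitzOnWith
    obtain ⟨C₂, t, ht, hlip₂⟩ := hψ.exists_lipschitzOnWith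
    refine ⟨C₁ * (‖pr‖ * C₂), ?_⟩
    have hc1 : ContinuousAt (fun x => (φ.leftFun x₀, φ.rightFun x)) x₀ :=
      continuousAt_const.prodMk hrC.continuousAt
    have hc2 : ContinuousAt (fun x => (φ.leftFun x, φ.rightFun x)) x₀ :=
      hlC.continuousAt.prodMk hrC.continuousAt
    filter_upwards [hc1.eventually hs, hc2.eventually hs, hG.continuousAt.eventually ht, happ]
      with x h1 h2 h3 h4
    have h5 := hlip.dist_le_mul _ h1 _ h2
    have h6 := hlip₂.dist_le_mul _ h3 _ (mem_of_mem_nhds ht)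
    have h7 : φ.implicitFunction.uncurry (φ.leftFun x, φ.rightFun x) = x := h4
    rw [h7, dist_eq_norm, Prod.dist_eq, dist_self, max_eq_left dist_nonneg, dist_comm,
      dist_eq_norm] at h5
    rw [dist_eq_norm, dist_eq_norm] at h6
    calc _ ≤ C₁ * ‖φ.leftFun x - φ.leftFun x₀‖ := h5
      _ ≤ C₁ * (‖pr‖ * (C₂ * ‖G x - G x₀‖)) := by
        gcongr
        simp only [hl, hg, ← map_sub]
        exact (pr.le_opNorm _).trans (by gcongr)
      _ = _ := by ring

end Retraction

/-! ### Level sets tangent to an Euler vector field are affine. -/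

section AffineFibres

open Filter

variable {V B : Type*} [NormedAddCommGroup V] [NormedSpace ℝ V] [NormedAddCommGroup B]
  [NormedSpace ℝ B]

/-- Grönwall's inequality on an interval to the right of `t₀`; the left side is reached later by
reversing time. -/
theorem eventually_nhdsGE_eq_zero_of_norm_deriv_le {f f' : ℝ → B} {t₀ K : ℝ} (h0 : f t₀ = 0)
    (hf : ∀ᶠ t in 𝓝 t₀, HasDerivAt f (f' t) t ∧ ‖f' t‖ ≤ K * ‖f t‖) :
    ∀ᶠ t in 𝓝[≥] t₀, f t = 0 := by
  obtain ⟨ε, hε, h⟩ := Metric.eventually_nhds_iff_ball.1 hf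
  have hmem : ∀ t ∈ Icc t₀ (t₀ + ε / 2), t ∈ Metric.ball t₀ ε := by
    intro t ht
    rw [Metric.mem_ball, Real.dist_eq, abs_lt]
    constructor <;> linarith [ht.1, ht.2]
  have hz := eq_zero_of_abs_deriv_le_mul_abs_self_of_eq_zero_right (f := f) (f' := f') (K := K)
    (a := t₀) (b := t₀ + ε / 2)
    (fun t ht => (h t (hmem t ht)).1.continuousAt.continuousWithinAt)
    (fun t ht => (h t (hmem t (Ico_subset_Icc_self ht))).1.hasDerivWithinAt) h0
    (fun t ht => (h t (hmem t (Ico_subset_Icc_self ht))).2)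
  filter_upwards [Icc_mem_nhdsGE (show t₀ < t₀ + ε / 2 by linarith)] with t ht using hz t ht

/-- A function with `‖f'‖ ≤ K ‖f‖` which vanishes at a point vanishes nearby. -/
theorem eventually_eq_zero_of_norm_deriv_le {f f' : ℝ → B} {t₀ K : ℝ} (h0 : f t₀ = 0)
    (hf : ∀ᶠ t in 𝓝 t₀, HasDerivAt f (f' t) t ∧ ‖f' t‖ ≤ K * ‖f t‖) :
    ∀ᶠ t in 𝓝 t₀, f t = 0 := by
  have hpos := eventually_nhdsGE_eq_zero_of_norm_deriv_le h0 hf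
  have hneg : ∀ᶠ t in 𝓝[≥] (-t₀), f (-t) = 0 := by
    refine eventually_nhdsGE_eq_zero_of_norm_deriv_le (f := fun t => f (-t))
      (f' := fun t => -f' (-t)) (K := K) (by simpa using h0) ?_
    have hc : Tendsto (fun t : ℝ => -t) (𝓝 (-t₀)) (𝓝 t₀) := by
      simpa using (continuous_neg.tendsto (-t₀))
    filter_upwards [hc.eventually hf] with t ht
    refine ⟨?_, by simpa using ht.2⟩
    simpa [Function.comp_def] using ht.1.scomp t (hasDerivAt_neg t)
  rw [← nhdsLE_sup_nhdsGE, eventually_sup]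
  refine ⟨?_, hpos⟩
  have hc : Tendsto (fun t : ℝ => -t) (𝓝[≤] t₀) (𝓝[≥] (-t₀)) :=
    tendsto_nhdsWithin_iff.2 ⟨(continuous_neg.tendsto t₀).mono_left nhdsWithin_le_nhds,
      eventually_nhdsWithin_of_forall fun t ht => by simpa using ht⟩
  filter_upwards [hc.eventually hneg] with t ht
  simpa using ht

/-- The level set `{H = p}` has local `C¹` retractions, which move the points by at most a multiple
of `‖H b - p‖`. -/
def HasRetractions (H : V → B) (p : B) : Prop :=
  ∀ b₀, H b₀ = p → ∃ r : V → V, ContDiffAt ℝ 1 r b₀ ∧ (∀ᶠ b in 𝓝 b₀, H (r b) = p) ∧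
    (∀ᶠ b in 𝓝 b₀, H b = p → r b = b) ∧ ∃ C : ℝ, ∀ᶠ b in 𝓝 b₀, ‖r b - b‖ ≤ C * ‖H b - p‖

variable {H : V → B} {p : B}

/-- If the Euler vector field `b ↦ u - b` is tangent to the level set `{H = p}`, then this set is a
cone with vertex `u`. -/
theorem ray_mem_level (hH : ContDiff ℝ ∞ H) (hr : HasRetractions H p) {u : V}
    (hu : ∀ b, H b = p → fderiv ℝ H b (u - b) = 0) {b : V} (hb : H b = p) {t : ℝ} (ht : 0 ≤ t) :
    H (u + t • (b - u)) = p := by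
  set c : ℝ → V := fun t => u + t • (b - u) with hc
  have hcd : ∀ t, HasDerivAt c (b - u) t := fun t => by
    have := ((hasDerivAt_id t).smul_const (b - u)).const_add u
    rwa [one_smul] at this
  have hcc : Continuous c := by fun_prop
  -- On the ray, `u - c t = -t (b - u)`, so the derivative of `H (c t)` is controlled by `D y = dH_y
  -- (u - y)` at `y = c t`, divided by `t`. As `D` is Lipschitz and vanishes at `r y`, which is
  -- within `C ‖H y - p‖` of `y`, Grönwall applies. The factor `2 / t₀` comes from `t > t₀ / 2`.
  have hopen : ∀ t₀, 0 < t₀ → H (c t₀) = p → ∀ᶠ t in 𝓝 t₀, H (c t) = p := by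
    intro t₀ ht₀ h0
    obtain ⟨r, hrC, hrF, hrid, C, hC⟩ := hr _ h0
    have hrc : r (c t₀) = c t₀ := hrid.self_of_nhds h0
    have hD : ContDiffAt ℝ 1 (fun y => fderiv ℝ H y (u - y)) (c t₀) :=
      (((hH.of_le (m := 2) (right_eq_inf.mp rfl)).fderiv_right (m := 1) (by norm_num)).clm_apply
        (contDiff_const.sub contDiff_id)).contDiffAt
    obtain ⟨K, s, hs, hlip⟩ := hD.exists_lipschitzOnWith
    have hs' : ∀ᶠ y in 𝓝 (c t₀), r y ∈ s := hrC.continuousAt.eventually (by rwa [hrc])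
    have hev := (hcc.tendsto t₀).eventually (hC.and (hrF.and (hs'.and hs)))
    have hzero : ∀ᶠ t in 𝓝 t₀, H (c t) - p = 0 := by
      refine eventually_eq_zero_of_norm_deriv_le (f' := fun t => fderiv ℝ H (c t) (b - u))
        (K := 2 / t₀ * (K * C)) (sub_eq_zero.2 h0) ?_
      filter_upwards [hev, lt_mem_nhds (show t₀ / 2 < t₀ by linarith)] with t ⟨h1, h2, h3, h4⟩ h5
      constructor
      · exact (((hH.differentiable (by simp)) (c t)).hasFDerivAt.comp_hasDerivAt t
          (hcd t)).sub_const p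
      · have h6 := hlip.dist_le_mul _ h4 _ h3
        rw [hu _ h2, dist_zero_right, dist_comm, dist_eq_norm] at h6
        have h7 : u - c t = -(t • (b - u)) := by simp only [hc]; abel
        rw [h7, map_neg, norm_neg, map_smul, norm_smul, Real.norm_eq_abs,
          abs_of_pos (by linarith)] at h6
        have h8 : t₀ / 2 * ‖fderiv ℝ H (c t) (b - u)‖ ≤ K * (C * ‖H (c t) - p‖) :=
          (mul_le_mul_of_nonneg_right h5.le (norm_nonneg _)).trans
            (h6.trans (by gcongr))
        calc _ = 2 / t₀ * (t₀ / 2 * ‖fderiv ℝ H (c t) (b - u)‖) := by field_simp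
          _ ≤ 2 / t₀ * (K * (C * ‖H (c t) - p‖)) := by gcongr
          _ = _ := by ring
    filter_upwards [hzero] with t ht using sub_eq_zero.1 ht
  have hclosed : IsClosed {t | H (c t) = p} := isClosed_eq (hH.continuous.comp hcc) continuous_const
  have hsub : Ioi (0 : ℝ) ⊆ interior {t | H (c t) = p} := by
    refine isPreconnected_Ioi.subset_of_closure_inter_subset isOpen_interior
      ⟨1, mem_Ioi.2 one_pos, mem_interior_iff_mem_nhds.2 (hopen 1 one_pos (by simpa [hc] using hb))⟩ ?_
    rintro t ⟨h1, h2⟩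
    exact mem_interior_iff_mem_nhds.2
      (hopen t h2 (hclosed.closure_subset_iff.2 interior_subset h1))
  -- The estimate degenerates at `t = 0`; the vertex is reached by closedness alone.
  have : closure (Ioi (0 : ℝ)) ⊆ {t | H (c t) = p} :=
    hclosed.closure_subset_iff.2 (hsub.trans interior_subset)
  rw [closure_Ioi] at this
  exact this ht

/-- A vector `w` with `dH w = 0` at a point of `{H = p}` is the velocity of a curve in this level
set. -/
theorem exists_curve_level (hH : ContDiff ℝ ∞ H) (hr : HasRetractions H p) {b w : V}
    (hb : H b = p) (hw : fderiv ℝ H b w = 0) :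
    ∃ γ : ℝ → V, γ 0 = b ∧ HasDerivAt γ w 0 ∧ ∀ᶠ t in 𝓝 0, H (γ t) = p := by
  obtain ⟨r, hrC, hrF, hrid, C, hC⟩ := hr _ hb
  set c : ℝ → V := fun t => b + t • w with hc
  have hc0 : c 0 = b := by simp [hc]
  have hcd : HasDerivAt c w 0 := by
    have := ((hasDerivAt_id (0 : ℝ)).smul_const w).const_add b
    rwa [one_smul] at this
  have hct : Tendsto c (𝓝 0) (𝓝 b) := by
    have := hcd.continuousAt.tendsto
    rwa [hc0] at this
  have hHc : HasDerivAt (fun t => H (c t)) 0 0 := by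
    have := (hc0 ▸ (hH.differentiable (by simp) b).hasFDerivAt :
      HasFDerivAt H (fderiv ℝ H b) (c 0)).comp_hasDerivAt 0 hcd
    rwa [hw] at this
  -- The correction is at most `C ‖H (c t) - p‖`, which is `o(t)` because `dH w = 0`; so retracting
  -- the straight line does not change its velocity.
  have hγ : HasDerivAt (fun t => r (c t) - c t) 0 0 := by
    rw [hasDerivAt_iff_isLittleO_nhds_zero] at hHc ⊢
    simp only [zero_add, smul_zero, sub_zero, hc0, hb, hrid.self_of_nhds hb, sub_self] at hHc ⊢
    refine Asymptotics.IsBigO.trans_isLittleO (Asymptotics.IsBigO.of_bound C ?_) hHc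
    exact hct.eventually hC
  refine ⟨fun t => r (c t), (congrArg r hc0).trans (hrid.self_of_nhds hb), ?_, hct.eventually hrF⟩
  have := hγ.add hcd
  rw [zero_add] at this
  exact this.congr_of_eventuallyEq (Eventually.of_forall fun t => by simp)

/-- If the Euler vector field `b ↦ u - b` is tangent to the level set `{H = p}`, then this set is
affine. -/
theorem add_mem_level (hH : ContDiff ℝ ∞ H) (hr : HasRetractions H p) {u : V}
    (hu : ∀ b, H b = p → fderiv ℝ H b (u - b) = 0) {b w : V} (hb : H b = p)
    (hw : fderiv ℝ H b w = 0) : H (b + w) = p := by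
  have hdiff := hH.differentiable (by simp)
  -- Homotheties of centre `u` and ratio `s > 0` preserve the level set. They carry a curve with
  -- velocity `w'` to one with velocity `s • w'`, so `w'` is in the kernel at `u + s (b - u)`; then
  -- `s → 0`.
  have hker : ∀ w', fderiv ℝ H b w' = 0 → fderiv ℝ H u w' = 0 := by
    intro w' hw'
    obtain ⟨γ, hγ0, hγ, hγF⟩ := exists_curve_level hH hr hb hw'
    have hpos : ∀ s : ℝ, 0 < s → fderiv ℝ H (u + s • (b - u)) w' = 0 := by
      intro s hs
      have h1 : HasDerivAt (fun t => u + s • (γ t - u)) (s • w') 0 :=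
        ((hγ.sub_const u).const_smul s).const_add u
      have h2 : HasDerivAt (fun t => H (u + s • (γ t - u)))
          (fderiv ℝ H (u + s • (b - u)) (s • w')) 0 := by
        have h3 := (hdiff (u + s • (γ 0 - u))).hasFDerivAt.comp_hasDerivAt 0 h1
        rwa [hγ0] at h3
      have h3 : HasDerivAt (fun t => H (u + s • (γ t - u))) 0 0 := by
        refine (hasDerivAt_const (0 : ℝ) p).congr_of_eventuallyEq ?_
        filter_upwards [hγF] with t ht using ray_mem_level hH hr hu ht hs.le
      have h4 := h2.unique h3
      rw [map_smul] at h4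
      exact (smul_eq_zero.1 h4).resolve_left hs.ne'
    have hcont : Continuous fun s : ℝ => fderiv ℝ H (u + s • (b - u)) w' := by
      have := hH.continuous_fderiv (by simp)
      fun_prop
    have hcl : closure (Ioi (0 : ℝ)) ⊆ {s | fderiv ℝ H (u + s • (b - u)) w' = 0} :=
      (isClosed_eq hcont continuous_const).closure_subset_iff.2 hpos
    rw [closure_Ioi] at hcl
    simpa using hcl (self_mem_Ici (a := (0 : ℝ)))
  have huF : H u = p := by simpa using ray_mem_level hH hr hu hb le_rfl
  have hwu : fderiv ℝ H u (b - u + w) = 0 := by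
    have h1 := hker _ (hu b hb)
    rw [map_add, hker w hw, add_zero, ← neg_sub, map_neg, h1, neg_zero]
  obtain ⟨γ, hγ0, hγ, hγF⟩ := exists_curve_level hH hr huF hwu
  -- Blow-up at the vertex: a curve in the cone leaving `u` with velocity `b - u + w`, dilated by
  -- `t⁻¹`, stays in the cone and converges to `b + w`.
  have hlim : Tendsto (fun t : ℝ => u + t⁻¹ • (γ t - u)) (𝓝[>] 0) (𝓝 (u + (b - u + w))) := by
    have := hγ.tendsto_slope_zero_right
    simp only [zero_add, hγ0] at this
    exact this.const_add u
  have hev : ∀ᶠ t : ℝ in 𝓝[>] 0, H (u + t⁻¹ • (γ t - u)) = p := by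
    filter_upwards [hγF.filter_mono nhdsWithin_le_nhds, self_mem_nhdsWithin] with t ht h0
    exact ray_mem_level hH hr hu ht (inv_nonneg.2 (le_of_lt h0))
  have h1 := ((hH.continuous.tendsto _).comp hlim)
  have h2 : Tendsto (H ∘ fun t : ℝ => u + t⁻¹ • (γ t - u)) (𝓝[>] 0) (𝓝 p) :=
    tendsto_const_nhds.congr' (by filter_upwards [hev] with t ht using ht.symm)
  have h3 := tendsto_nhds_unique h1 h2
  rwa [show u + (b - u + w) = b + w by abel] at h3

/-- A function whose differential vanishes on the tangent vectors of a connected level set is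
constant on this level set. -/
theorem eq_of_fderiv_eq_zero_on_level (hH : Differentiable ℝ H) (hr : HasRetractions H p)
    (hconn : IsPreconnected {b | H b = p}) {R : V → ℝ} (hR : Differentiable ℝ R)
    (hzero : ∀ b w, H b = p → fderiv ℝ H b w = 0 → fderiv ℝ R b w = 0) {b b' : V} (hb : H b = p)
    (hb' : H b' = p) : R b = R b' := by
  refine hconn.induction₂ (fun x y => R x = R y) ?_ (fun _ _ _ _ _ _ h h' => h.trans h')
    (fun _ _ _ _ h => h.symm) hb hb'
  intro x hx
  obtain ⟨r, hrC, hrF, hrid, -⟩ := hr _ hx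
  have hrd : ∀ᶠ y in 𝓝 x, DifferentiableAt ℝ r y :=
    (hrC.eventually (by simp)).mono fun y hy => hy.differentiableAt one_ne_zero
  obtain ⟨ε, hε, h⟩ := Metric.eventually_nhds_iff_ball.1
    ((hrF.eventually_nhds.and hrd).and hrid)
  -- `R ∘ r` has zero differential on a ball, since `dr` takes its values in the kernel of `dH`; and
  -- `r` is the identity on the level set.
  have hconst : ∀ y ∈ Metric.ball x ε, R (r y) = R (r x) := by
    intro y hy
    refine Metric.isOpen_ball.is_const_of_fderiv_eq_zero (𝕜 := ℝ) (f := R ∘ r)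
      (convex_ball x ε).isPreconnected
      (fun z hz => ((hR (r z)).comp z (h z hz).1.2).differentiableWithinAt) ?_ hy
      (Metric.mem_ball_self hε)
    intro z hz
    ext w
    rw [fderiv_comp z (hR (r z)) (h z hz).1.2]
    refine hzero _ _ (h z hz).1.1.self_of_nhds ?_
    have h1 : fderiv ℝ (H ∘ r) z = 0 := by
      have : H ∘ r =ᶠ[𝓝 z] fun _ => p := (h z hz).1.1
      rw [this.fderiv_eq, fderiv_fun_const, Pi.zero_apply]
    rw [fderiv_comp z (hH (r z)) (h z hz).1.2] at h1
    exact DFunLike.congr_fun h1 w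
  filter_upwards [nhdsWithin_le_nhds (Metric.ball_mem_nhds x hε), self_mem_nhdsWithin]
    with y hy hyF
  have h1 := hconst y hy
  rw [(h y hy).2 hyF, hrid.self_of_nhds hx] at h1
  exact h1.symm

end AffineFibres

/-! ### Bundle charts, and the Lagrangian and momenta in them. -/

section Coordinates

open Filter

variable {E : Type*} [NormedAddCommGroup E] [NormedSpace ℝ E]
  {Q : Type*} [TopologicalSpace Q] [ChartedSpace E Q] [IsManifold 𝓘(ℝ, E) ∞ Q] {k : ℕ}

section WrittenInExtChartAt

variable {V V' H H' M M' : Type*} [NormedAddCommGroup V]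
  [NormedSpace ℝ V] [TopologicalSpace H] {I : ModelWithCorners ℝ V H} [I.Boundaryless]
  [TopologicalSpace M] [ChartedSpace H M] [NormedAddCommGroup V'] [NormedSpace ℝ V']
  [TopologicalSpace H'] {I' : ModelWithCorners ℝ V' H'} [TopologicalSpace M']
  [ChartedSpace H' M'] {f : M → M'} {x : M}

theorem hasFDerivAt_writtenInExtChartAt {D : V →L[ℝ] V'} (hf : HasMFDerivAt I I' f x D) :
    HasFDerivAt (writtenInExtChartAt I I' x f) D (extChartAt I x x) := by
  have h : HasFDerivWithinAt (writtenInExtChartAt I I' x f) D (range I) (extChartAt I x x) := hf.2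
  rwa [I.range_eq_univ, hasFDerivWithinAt_univ] at h

/-- The differential at a point of a function, written in the preferred charts. -/
theorem mfderiv_eq_fderiv_writtenInExtChartAt (hf : MDifferentiableAt I I' f x) :
    mfderiv I I' f x = fderiv ℝ (writtenInExtChartAt I I' x f) (extChartAt I x x) :=
  (hasFDerivAt_writtenInExtChartAt (V := V) (V' := V') (D := mfderiv I I' f x)
    hf.hasMFDerivAt).fderiv.symm

end WrittenInExtChartAt

variable (k) in
/-- The chart of `T¹ₖQ` over the preferred chart of `Q` at `q`. -/
abbrev chartT (q : Q) : PartialEquiv (TkQ E Q k) (E × ((Fin k → ℝ) →L[ℝ] E)) :=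
  extChartAt (IT E k) (inFibre q 0 : TkQ E Q k)

/-- The differential at `q'` of the preferred chart of `Q` at `q`. -/
def frameAt (q q' : Q) : E →L[ℝ] E :=
  (trivializationAt E (TangentSpace 𝓘(ℝ, E)) q).continuousLinearMapAt ℝ q'

theorem chartT_apply (q : Q) (x : TkQ E Q k) :
    chartT k q x = (extChartAt 𝓘(ℝ, E) q x.proj, (frameAt q x.proj).comp (vel x)) := by
  have h1 : (trivializationAt (Fin k → ℝ) (Trivial Q (Fin k → ℝ)) q).symmL ℝ x.proj =
    ContinuousLinearMap.id ℝ (Fin k → ℝ) := Trivial.symmL_trivialization ℝ Q (Fin k → ℝ) x.proj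
  have h2 : chartT k q x = (extChartAt 𝓘(ℝ, E) q x.proj, (frameAt q x.proj).comp ((vel x).comp
    ((trivializationAt (Fin k → ℝ) (Trivial Q (Fin k → ℝ)) q).symmL ℝ x.proj :
      (Fin k → ℝ) →L[ℝ] (Fin k → ℝ)))) := rfl
  rw [h2, h1]
  rfl

theorem isManifold_one (E Q : Type*) [NormedAddCommGroup E] [NormedSpace ℝ E] [TopologicalSpace Q]
    [ChartedSpace E Q] [IsManifold 𝓘(ℝ, E) ∞ Q] : IsManifold 𝓘(ℝ, E) 1 Q :=
  IsManifold.of_le (n := ∞) (by simp)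

theorem frameAt_eq {q q' : Q} (h : q' ∈ (chartAt E q).source) :
    frameAt (E := E) q q' = (mfderiv 𝓘(ℝ, E) 𝓘(ℝ, E) (extChartAt 𝓘(ℝ, E) q) q' : E →L[ℝ] E) :=
  have := isManifold_one E Q
  TangentBundle.continuousLinearMapAt_trivializationAt (I := 𝓘(ℝ, E)) (𝕜 := ℝ) h

theorem frameAt_self (q : Q) : frameAt (E := E) q q = ContinuousLinearMap.id ℝ E := by
  have := isManifold_one E Q
  rw [frameAt_eq (mem_chart_source E q)]
  exact mfderiv_extChartAt_self

/-- Over the centre of its own chart the frame is the identity. Every point is `inFibre q v` for its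
base point `q`, so pointwise computations in this chart need no change of frame. -/
theorem chartT_inFibre (q : Q) (v : (Fin k → ℝ) →L[ℝ] E) :
    chartT k q (inFibre q v) = (extChartAt 𝓘(ℝ, E) q q, v) := by
  rw [chartT_apply]
  change (_, (frameAt q q).comp v) = _
  rw [frameAt_self]
  rfl

theorem chartT_source (q : Q) :
    (chartT k q).source = {x : TkQ E Q k | x.proj ∈ (chartAt E q).source} := by
  rw [extChartAt_source, FiberBundle.chartedSpace_chartAt]
  ext x
  simp only [OpenPartialHomeomorph.trans_source, hom_trivializationAt_source]
  simp
  exact ⟨fun h => h.1, fun h => ⟨h, h⟩⟩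

theorem chartT_target (q : Q) :
    (chartT k q).target = (extChartAt 𝓘(ℝ, E) q : PartialEquiv Q E).target ×ˢ univ := by
  have h : ∀ a ∈ (extChartAt 𝓘(ℝ, E) q : PartialEquiv Q E).target,
    (extChartAt 𝓘(ℝ, E) q).symm a ∈ (chartAt E q).source := fun a ha => by
      simpa using (extChartAt 𝓘(ℝ, E) q).map_target ha
  rw [FiberBundle.extChartAt_target]
  rw [inter_eq_left.2]
  · rfl
  · intro a ha
    rw [mem_preimage, hom_trivializationAt_baseSet]
    exact ⟨mem_univ _, h a ha⟩

theorem contMDiff_inFibre (q : Q) :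
    ContMDiff 𝓘(ℝ, (Fin k → ℝ) →L[ℝ] E) (IT E k) ∞ (inFibre q : _ → TkQ E Q k) := by
  intro v
  refine contMDiffAt_totalSpace.2 ⟨contMDiffAt_const, ?_⟩
  refine (contMDiffAt_id (n := ∞)).congr_of_eventuallyEq (Eventually.of_forall fun v' => ?_)
  exact congrArg Prod.snd (chartT_inFibre q v')

variable (L : TkQ E Q k → ℝ)

/-- The Lagrangian, in the chart of `T¹ₖQ` over the preferred chart of `Q` at `q`. -/
def locL (q : Q) : E × ((Fin k → ℝ) →L[ℝ] E) → ℝ := L ∘ (chartT k q).symm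

/-- The Legendre transformation, in the charts over the preferred chart of `Q` at `q`. -/
def locP (q : Q) (y : E × ((Fin k → ℝ) →L[ℝ] E)) : E →L[ℝ] (Fin k → ℝ) :=
  ContinuousLinearMap.pi fun α => (fderiv ℝ (locL L q) y).comp
    ((ContinuousLinearMap.inr ℝ E ((Fin k → ℝ) →L[ℝ] E)).comp (single α))

variable {L}

theorem isOpen_chartT_target (q : Q) : IsOpen (chartT (E := E) k q).target :=
  isOpen_extChartAt_target _

theorem contDiffOn_locL (hL : ContMDiff (IT E k) 𝓘(ℝ, ℝ) ∞ L) (q : Q) :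
    ContDiffOn ℝ ∞ (locL L q) (chartT k q).target :=
  contMDiffOn_iff_contDiffOn.1 (hL.comp_contMDiffOn (contMDiffOn_extChartAt_symm _))

theorem fderiv_fibre (hL : ContMDiff (IT E k) 𝓘(ℝ, ℝ) ∞ L) {q : Q} {x : TkQ E Q k}
    (hx : x ∈ (chartT k q).source) :
    fderiv ℝ (fun v : (Fin k → ℝ) →L[ℝ] E => L (inFibre x.proj v)) (vel x) =
      (fderiv ℝ (locL L q) (chartT k q x)).comp
        ((ContinuousLinearMap.inr ℝ E ((Fin k → ℝ) →L[ℝ] E)).comp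
          (ContinuousLinearMap.compL ℝ (Fin k → ℝ) E E (frameAt q x.proj))) := by
  rw [chartT_source] at hx
  have h1 : ∀ v, L (inFibre x.proj v) = locL L q (extChartAt 𝓘(ℝ, E) q x.proj,
      ContinuousLinearMap.compL ℝ (Fin k → ℝ) E E (frameAt q x.proj) v) := by
    intro v
    have h2 : (inFibre x.proj v : TkQ E Q k) ∈ (chartT k q).source := by
      rw [chartT_source]
      exact hx
    have h3 := chartT_apply q (inFibre x.proj v : TkQ E Q k)
    rw [locL, Function.comp_apply]
    exact congrArg L (((chartT k q).left_inv h2).symm.trans (congrArg _ h3))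
  simp_rw [h1]
  have h4 : chartT k q x ∈ (chartT k q).target :=
    (chartT k q).map_source (by rwa [chartT_source])
  have h5 : DifferentiableAt ℝ (locL L q) (chartT k q x) :=
    ((contDiffOn_locL hL q).contDiffAt ((isOpen_chartT_target q).mem_nhds h4)).differentiableAt
      (by simp)
  have h6 : HasFDerivAt (fun v => (extChartAt 𝓘(ℝ, E) q x.proj,
      ContinuousLinearMap.compL ℝ (Fin k → ℝ) E E (frameAt q x.proj) v))
      ((ContinuousLinearMap.inr ℝ E ((Fin k → ℝ) →L[ℝ] E)).comp
          (ContinuousLinearMap.compL ℝ (Fin k → ℝ) E E (frameAt q x.proj))) (vel x) := by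
    refine ((hasFDerivAt_const (extChartAt 𝓘(ℝ, E) q x.proj) (vel x)).prodMk
      (ContinuousLinearMap.hasFDerivAt
        (ContinuousLinearMap.compL ℝ (Fin k → ℝ) E E (frameAt q x.proj)))).congr_fderiv ?_
    ext1 v
    rfl
  have h7 := chartT_apply q x
  rw [h7] at h5 ⊢
  exact (HasFDerivAt.comp (vel x) h5.hasFDerivAt h6).fderiv

theorem dFun_comp_vertical (hL : ContMDiff (IT E k) 𝓘(ℝ, ℝ) ∞ L) (x : TkQ E Q k) :
    (dFun L x).comp (vertical x) =
      fderiv ℝ (fun v : (Fin k → ℝ) →L[ℝ] E => L (inFibre x.proj v)) (vel x) := by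
  rw [← mfderiv_eq_fderiv]
  exact (mfderiv_comp (vel x) (hL.mdifferentiable (by simp) _)
    ((contMDiff_inFibre x.proj).mdifferentiable (by simp) _)).symm

variable (L) in
/-- The momenta of a point of `T¹ₖQ`: the vector part of its image by the Legendre
transformation. -/
def momenta (x : TkQ E Q k) : E →L[ℝ] (Fin k → ℝ) := (legendre L x).snd

/-- The Cartan forms are tautological: a momentum composed with `Tπ`. -/
theorem cartanOne_apply (hL : ContMDiff (IT E k) 𝓘(ℝ, ℝ) ∞ L) (α : Fin k) (x : TkQ E Q k)
    (u : TT x) : cartanOne L α x u = momenta L x (dProj x u) α := by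
  have h : ∀ w, dFun L x (vertical x w) =
      fderiv ℝ (fun v : (Fin k → ℝ) →L[ℝ] E => L (inFibre x.proj v)) (vel x) w :=
    fun w => DFunLike.congr_fun (dFun_comp_vertical hL x) w
  exact h _

theorem comp_single (A : E →L[ℝ] E) (α : Fin k) (u : E) :
    A.comp (single α u) = single α (A u) := by
  ext v
  simp [single]

theorem momenta_eq (hL : ContMDiff (IT E k) 𝓘(ℝ, ℝ) ∞ L) {q : Q} {x : TkQ E Q k}
    (hx : x ∈ (chartT k q).source) :
    momenta L x = (locP L q (chartT k q x)).comp (frameAt q x.proj) := by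
  have h : ∀ (u : E) (α : Fin k),
      fderiv ℝ (fun v : (Fin k → ℝ) →L[ℝ] E => L (inFibre x.proj v)) (vel x) (single α u) =
      fderiv ℝ (locL L q) (chartT k q x) (0, single α (frameAt q x.proj u)) := by
    intro u α
    rw [fderiv_fibre hL hx, ← comp_single]
    rfl
  ext u
  exact h u _

/-- The point `(q; p)` of `(T¹ₖ)*Q` over `q`. -/
def inFibreStar (q : Q) (p : E →L[ℝ] (Fin k → ℝ)) : TkStarQ E Q k := ⟨q, p⟩

theorem legendre_inFibre (hL : ContMDiff (IT E k) 𝓘(ℝ, ℝ) ∞ L) (q : Q)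
    (v : (Fin k → ℝ) →L[ℝ] E) :
    legendre L (inFibre q v) = inFibreStar q (locP L q (extChartAt 𝓘(ℝ, E) q q, v)) := by
  have hx : (inFibre q v : TkQ E Q k) ∈ (chartT k q).source := by
    rw [chartT_source]
    exact mem_chart_source E q
  have h := momenta_eq hL hx
  rw [chartT_inFibre] at h
  change TotalSpace.mk q _ = _
  congr 1
  refine h.trans ?_
  change (locP L q _).comp (frameAt q q) = _
  rw [frameAt_self]
  rfl

end Coordinates

/-! ### Coordinate expressions of the geometric objects. -/

section Differentials

open Filter

variable {E : Type*} [NormedAddCommGroup E] [NormedSpace ℝ E]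
  {Q : Type*} [TopologicalSpace Q] [ChartedSpace E Q] [IsManifold 𝓘(ℝ, E) ∞ Q] {k : ℕ}

theorem inFibre_mem_source (q : Q) (v : (Fin k → ℝ) →L[ℝ] E) :
    (inFibre q v : TkQ E Q k) ∈ (chartT k q).source := by
  rw [chartT_source]
  exact mem_chart_source E q

theorem chartPoint_mem_target (q : Q) (v : (Fin k → ℝ) →L[ℝ] E) :
    (extChartAt 𝓘(ℝ, E) q q, v) ∈ (chartT (E := E) k q).target := by
  have := (chartT k q).map_source (inFibre_mem_source q v)
  rwa [chartT_inFibre] at this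

theorem proj_chartT_symm {q : Q} {y : E × ((Fin k → ℝ) →L[ℝ] E)} (hy : y ∈ (chartT k q).target) :
    ((chartT k q).symm y).proj = (extChartAt 𝓘(ℝ, E) q).symm y.1 := by
  have h1 := (chartT k q).map_target hy
  have h2 := congrArg Prod.fst ((chartT_apply q _).symm.trans ((chartT k q).right_inv hy))
  rw [chartT_source] at h1
  rw [← h2]
  exact ((extChartAt 𝓘(ℝ, E) q).left_inv (by rw [extChartAt_source]; exact h1)).symm

theorem contMDiff_proj_TkQ :
    ContMDiff (IT E k) 𝓘(ℝ, E) ∞ (TotalSpace.proj : TkQ E Q k → Q) :=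
  contMDiff_proj _

/-- In a chart, the differential of the projection is the first projection. -/
theorem dProj_inFibre (q : Q) (v : (Fin k → ℝ) →L[ℝ] E) (u : E × ((Fin k → ℝ) →L[ℝ] E)) :
    dProj (inFibre q v) u = u.1 := by
  have h := mfderiv_eq_fderiv_writtenInExtChartAt
    ((contMDiff_proj_TkQ (E := E) (Q := Q) (k := k)).mdifferentiable (by simp) (inFibre q v))
  have h2 : writtenInExtChartAt (IT E k) 𝓘(ℝ, E) (inFibre q v)
      (TotalSpace.proj : TkQ E Q k → Q) =ᶠ[𝓝 (chartT k q (inFibre q v))] Prod.fst := by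
    rw [chartT_inFibre]
    filter_upwards [(isOpen_chartT_target q).mem_nhds (chartPoint_mem_target q v)] with y hy
    change extChartAt 𝓘(ℝ, E) q ((chartT k q).symm y).proj = y.1
    rw [proj_chartT_symm hy]
    rw [chartT_target] at hy
    exact (extChartAt 𝓘(ℝ, E) q).right_inv hy.1
  have h3 : fderiv ℝ (writtenInExtChartAt (IT E k) 𝓘(ℝ, E) (inFibre q v)
      (TotalSpace.proj : TkQ E Q k → Q)) (chartT k q (inFibre q v)) = ContinuousLinearMap.fst ℝ _ _ :=
    h2.fderiv_eq.trans fderiv_fst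
  exact DFunLike.congr_fun (h.trans h3) u

/-- In a chart, vertical vectors are the vectors with vanishing first component. -/
theorem vertical_inFibre (q : Q) (v w : (Fin k → ℝ) →L[ℝ] E) :
    vertical (inFibre q v : TkQ E Q k) w = ((0, w) : E × ((Fin k → ℝ) →L[ℝ] E)) := by
  have h := mfderiv_eq_fderiv_writtenInExtChartAt
    ((contMDiff_inFibre (E := E) (k := k) q).mdifferentiable (by simp) v)
  have h2 : writtenInExtChartAt 𝓘(ℝ, (Fin k → ℝ) →L[ℝ] E) (IT E k) v
      (inFibre q : _ → TkQ E Q k) = fun v => (extChartAt 𝓘(ℝ, E) q q, v) :=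
    funext fun v' => chartT_inFibre q v'
  have h3 : fderiv ℝ (writtenInExtChartAt 𝓘(ℝ, (Fin k → ℝ) →L[ℝ] E) (IT E k) v
      (inFibre q : _ → TkQ E Q k)) v = ContinuousLinearMap.inr ℝ _ _ := by
    rw [h2]
    exact (hasFDerivAt_prodMk_right _ _).fderiv
  exact DFunLike.congr_fun (h.trans h3) w

theorem J_inFibre (α : Fin k) (q : Q) (v : (Fin k → ℝ) →L[ℝ] E)
    (u : E × ((Fin k → ℝ) →L[ℝ] E)) :
    J α (inFibre q v) u = ((0, single α u.1) : E × ((Fin k → ℝ) →L[ℝ] E)) := by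
  have h : J α (inFibre q v) u =
    vertical (inFibre q v : TkQ E Q k) (single α (dProj (inFibre q v) u : E)) := rfl
  rw [h, vertical_inFibre, dProj_inFibre]

theorem sum_single (v : (Fin k → ℝ) →L[ℝ] E) :
    ∑ α, single α (v (Pi.single α 1)) = v := by
  ext1 t
  conv_rhs => rw [← Finset.univ_sum_single t, map_sum]
  rw [sum_apply]
  refine Finset.sum_congr rfl fun α _ => ?_
  have : (Pi.single α (t α) : Fin k → ℝ) = t α • Pi.single α 1 := by
    rw [← Pi.single_smul, smul_eq_mul, mul_one]
  rw [this, map_smul]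
  rfl

theorem liouville_eq_vertical (x : TkQ E Q k) : liouville x = vertical x (vel x) := by
  have h : liouville x = ∑ α, vertical x (single α (vel x (Pi.single α 1))) := rfl
  have h2 : ∀ D : ((Fin k → ℝ) →L[ℝ] E) →L[ℝ] (E × ((Fin k → ℝ) →L[ℝ] E)),
      ∑ α, D (single α (vel x (Pi.single α 1))) = D (vel x) := by
    intro D
    rw [← map_sum, sum_single]
  rw [h]
  exact h2 (vertical x)

variable {L : TkQ E Q k → ℝ}

theorem dFun_inFibre {f : TkQ E Q k → ℝ} {q : Q} {v : (Fin k → ℝ) →L[ℝ] E}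
    (hf : MDifferentiableAt (IT E k) 𝓘(ℝ, ℝ) f (inFibre q v)) (u : E × ((Fin k → ℝ) →L[ℝ] E)) :
    dFun f (inFibre q v) u =
      fderiv ℝ (f ∘ (chartT k q).symm) (extChartAt 𝓘(ℝ, E) q q, v) u := by
  have h := mfderiv_eq_fderiv_writtenInExtChartAt hf
  have h2 : extChartAt (IT E k) (inFibre q v) (inFibre q v) = (extChartAt 𝓘(ℝ, E) q q, v) :=
    chartT_inFibre q v
  rw [h2] at h
  exact DFunLike.congr_fun h u

/-- The energy, in a chart. -/
theorem energy_chartT_symm (hL : ContMDiff (IT E k) 𝓘(ℝ, ℝ) ∞ L) {q : Q}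
    {y : E × ((Fin k → ℝ) →L[ℝ] E)} (hy : y ∈ (chartT k q).target) :
    energy L ((chartT k q).symm y) = fderiv ℝ (locL L q) y (0, y.2) - locL L q y := by
  set x := (chartT k q).symm y with hx
  have hxs : x ∈ (chartT k q).source := (chartT k q).map_target hy
  have hxy : chartT k q x = y := (chartT k q).right_inv hy
  have h1 : energy L x = (dFun L x).comp (vertical x) (vel x) - L x := by
    rw [energy, liouville_eq_vertical]
    rfl
  have h2 : (frameAt q x.proj).comp (vel x) = y.2 :=
    (congrArg Prod.snd (chartT_apply q x)).symm.trans (congrArg Prod.snd hxy)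
  rw [h1, dFun_comp_vertical hL, fderiv_fibre hL hxs, hxy]
  rw [← h2]
  rfl

theorem contDiffOn_locP (hL : ContMDiff (IT E k) 𝓘(ℝ, ℝ) ∞ L) (q : Q) :
    ContDiffOn ℝ ∞ (locP L q) (chartT k q).target := by
  -- Smoothness of a map built with `pi` is obtained by writing it as a finite sum of compositions
  -- with coordinate inclusions.
  have h1 : ContDiffOn ℝ ∞ (fderiv ℝ (locL L q)) (chartT k q).target :=
    (contDiffOn_locL hL q).fderiv_of_isOpen (isOpen_chartT_target q) (by simp)
  have h2 : locP L q = fun y => ∑ α, (ContinuousLinearMap.single ℝ (fun _ => ℝ) α).comp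
      ((fderiv ℝ (locL L q) y).comp
        ((ContinuousLinearMap.inr ℝ E ((Fin k → ℝ) →L[ℝ] E)).comp (single α))) := by
    ext y u β
    simp [locP, Finset.sum_apply, Pi.single_apply]
  rw [h2]
  exact ContDiffOn.sum fun α _ =>
    contDiffOn_const.clm_comp (h1.clm_comp contDiffOn_const)

theorem contDiffAt_locP (hL : ContMDiff (IT E k) 𝓘(ℝ, ℝ) ∞ L) (q : Q)
    (v : (Fin k → ℝ) →L[ℝ] E) : ContDiffAt ℝ ∞ (locP L q) (extChartAt 𝓘(ℝ, E) q q, v) :=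
  (contDiffOn_locP hL q).contDiffAt
    ((isOpen_chartT_target q).mem_nhds (chartPoint_mem_target q v))

theorem contDiffAt_locL (hL : ContMDiff (IT E k) 𝓘(ℝ, ℝ) ∞ L) (q : Q)
    (v : (Fin k → ℝ) →L[ℝ] E) : ContDiffAt ℝ ∞ (locL L q) (extChartAt 𝓘(ℝ, E) q q, v) :=
  (contDiffOn_locL hL q).contDiffAt
    ((isOpen_chartT_target q).mem_nhds (chartPoint_mem_target q v))

variable (k) in
/-- The chart of `(T¹ₖ)*Q` over the preferred chart of `Q` at `q`. -/
abbrev chartTStar (q : Q) : PartialEquiv (TkStarQ E Q k) (E × (E →L[ℝ] (Fin k → ℝ))) :=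
  extChartAt (ITStar E k) (inFibreStar q 0 : TkStarQ E Q k)

theorem chartTStar_legendre (hL : ContMDiff (IT E k) 𝓘(ℝ, ℝ) ∞ L) {q : Q} {x : TkQ E Q k}
    (hx : x ∈ (chartT k q).source) :
    chartTStar k q (legendre L x) = ((chartT k q x).1, locP L q (chartT k q x)) := by
  have h1 : (trivializationAt (Fin k → ℝ) (Trivial Q (Fin k → ℝ)) q).continuousLinearMapAt ℝ
      x.proj = ContinuousLinearMap.id ℝ (Fin k → ℝ) :=
    Trivial.continuousLinearMapAt_trivialization ℝ Q (Fin k → ℝ) x.proj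
  obtain ⟨S, h2, h3⟩ : ∃ S : E →L[ℝ] E, chartTStar k q (legendre L x) =
      (extChartAt 𝓘(ℝ, E) q x.proj,
      ((trivializationAt (Fin k → ℝ) (Trivial Q (Fin k → ℝ)) q).continuousLinearMapAt ℝ x.proj :
        (Fin k → ℝ) →L[ℝ] (Fin k → ℝ)).comp ((momenta L x).comp S)) ∧
      ∀ u, frameAt (E := E) q x.proj (S u) = u := by
    refine ⟨(trivializationAt E (TangentSpace 𝓘(ℝ, E)) q).symmL ℝ x.proj, rfl, ?_⟩
    refine Trivialization.continuousLinearMapAt_symmL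
      (trivializationAt E (TangentSpace 𝓘(ℝ, E)) q) (R := ℝ) ?_
    rw [chartT_source] at hx
    exact hx
  rw [h2, h1, momenta_eq hL hx, chartT_apply]
  congr 1
  ext1 u
  exact congrArg (locP L q _) (h3 u)

theorem contMDiff_legendre (hL : ContMDiff (IT E k) 𝓘(ℝ, ℝ) ∞ L) :
    ContMDiff (IT E k) (ITStar E k) ∞ (legendre L) := by
  intro x
  obtain ⟨q, v, rfl⟩ : ∃ q v, x = inFibre q v := ⟨x.proj, vel x, rfl⟩
  refine contMDiffAt_totalSpace.2 ⟨contMDiff_proj_TkQ _, ?_⟩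
  have h1 : ContMDiffAt (IT E k) 𝓘(ℝ, E →L[ℝ] (Fin k → ℝ)) ∞
      (fun x => locP L q (chartT k q x)) (inFibre q v : TkQ E Q k) := by
    have h2 := (contDiffAt_locP hL q v).contMDiffAt
    rw [← chartT_inFibre q v] at h2
    have h3 : ContMDiffAt (IT E k) 𝓘(ℝ, E × ((Fin k → ℝ) →L[ℝ] E)) ∞ (chartT k q)
      (inFibre q v : TkQ E Q k) := contMDiffAt_extChartAt (I := IT E k) (x := inFibre q v)
    exact h2.comp _ h3
  refine h1.congr_of_eventuallyEq ?_
  filter_upwards [extChartAt_source_mem_nhds (I := IT E k) (inFibre q v : TkQ E Q k)] with x hx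
  exact congrArg Prod.snd (chartTStar_legendre hL hx)

/-- In the charts over a chart of `Q`, the differential of the Legendre transformation. -/
theorem dLegendre_inFibre (hL : ContMDiff (IT E k) 𝓘(ℝ, ℝ) ∞ L) (q : Q)
    (v : (Fin k → ℝ) →L[ℝ] E) (u : E × ((Fin k → ℝ) →L[ℝ] E)) :
    dLegendre L (inFibre q v) u =
      ((u.1, fderiv ℝ (locP L q) (extChartAt 𝓘(ℝ, E) q q, v) u) : E × (E →L[ℝ] (Fin k → ℝ))) := by
  have h := mfderiv_eq_fderiv_writtenInExtChartAt
    ((contMDiff_legendre hL).mdifferentiable (by simp) (inFibre q v))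
  have h2 : writtenInExtChartAt (IT E k) (ITStar E k) (inFibre q v) (legendre L)
      =ᶠ[𝓝 (extChartAt 𝓘(ℝ, E) q q, v)] fun y => (y.1, locP L q y) := by
    filter_upwards [(isOpen_chartT_target q).mem_nhds (chartPoint_mem_target q v)] with y hy
    have h3 := chartTStar_legendre hL ((chartT k q).map_target hy)
    rw [(chartT k q).right_inv hy] at h3
    exact h3
  have h4 : fderiv ℝ (writtenInExtChartAt (IT E k) (ITStar E k) (inFibre q v) (legendre L))
      (chartT k q (inFibre q v)) = (ContinuousLinearMap.fst ℝ _ _).prod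
        (fderiv ℝ (locP L q) (extChartAt 𝓘(ℝ, E) q q, v)) := by
    rw [chartT_inFibre, h2.fderiv_eq]
    exact (hasFDerivAt_fst.prodMk
      ((contDiffAt_locP hL q v).differentiableAt (by simp)).hasFDerivAt).fderiv
  exact DFunLike.congr_fun (h.trans h4) u

/-- The left side is the chain rule for chart of `Q` after `π` after inverse chart of `T¹ₖQ`, a
composition which is the first projection near `y`. Unlike `dProj_inFibre`, this holds away from the
fibre over `q`, as needed to differentiate the Cartan forms. -/
theorem frameAt_dProj_mfderiv_symm {q : Q} {y : E × ((Fin k → ℝ) →L[ℝ] E)}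
    (hy : y ∈ (chartT k q).target) (u : E × ((Fin k → ℝ) →L[ℝ] E)) :
    frameAt (E := E) q ((chartT k q).symm y).proj (dProj ((chartT k q).symm y)
      (mfderiv 𝓘(ℝ, E × ((Fin k → ℝ) →L[ℝ] E)) (IT E k) (chartT k q).symm y u) : E) = u.1 := by
  have := isManifold_one E Q
  set x := (chartT k q).symm y with hx
  have hxq : x.proj ∈ (chartAt E q).source := by
    have hxs : x ∈ (chartT k q).source := (chartT k q).map_target hy
    rwa [chartT_source] at hxs
  have hmd : MDifferentiableAt 𝓘(ℝ, E × ((Fin k → ℝ) →L[ℝ] E)) (IT E k) (chartT k q).symm y :=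
    ((contMDiffOn_extChartAt_symm (I := IT E k) (n := ∞) (inFibre q 0 : TkQ E Q k)).contMDiffAt
      ((isOpen_chartT_target q).mem_nhds hy)).mdifferentiableAt (by simp)
  set D : (E × ((Fin k → ℝ) →L[ℝ] E)) →L[ℝ] (E × ((Fin k → ℝ) →L[ℝ] E)) :=
    mfderiv 𝓘(ℝ, E × ((Fin k → ℝ) →L[ℝ] E)) (IT E k) (chartT k q).symm y with hD
  have h6 : MDifferentiableAt (IT E k) 𝓘(ℝ, E) (TotalSpace.proj : TkQ E Q k → Q) x :=
    contMDiff_proj_TkQ.mdifferentiable (by simp) x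
  have h7 : MDifferentiableAt 𝓘(ℝ, E) 𝓘(ℝ, E) (extChartAt 𝓘(ℝ, E) q) x.proj :=
    mdifferentiableAt_extChartAt hxq
  have h8 := h7.hasMFDerivAt.comp y (h6.hasMFDerivAt.comp y hmd.hasMFDerivAt)
  have h9 : HasMFDerivAt 𝓘(ℝ, E × ((Fin k → ℝ) →L[ℝ] E)) 𝓘(ℝ, E)
      (extChartAt 𝓘(ℝ, E) q ∘ TotalSpace.proj ∘ (chartT k q).symm) y
      (ContinuousLinearMap.fst ℝ E ((Fin k → ℝ) →L[ℝ] E)) := by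
    refine (hasMFDerivAt_iff_hasFDerivAt.2 hasFDerivAt_fst).congr_of_eventuallyEq ?_
    filter_upwards [(isOpen_chartT_target q).mem_nhds hy] with z hz
    change extChartAt 𝓘(ℝ, E) q ((chartT k q).symm z).proj = z.1
    rw [proj_chartT_symm hz]
    rw [chartT_target] at hz
    exact (extChartAt 𝓘(ℝ, E) q).right_inv hz.1
  exact (DFunLike.congr_fun (frameAt_eq hxq) (dProj x (D u) : E)).trans
    (DFunLike.congr_fun (hasMFDerivAt_unique h8 h9) u)

/-- In a chart, the Cartan forms are `θ^α = p^α dq`. -/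
theorem cartanOne_chart (hL : ContMDiff (IT E k) 𝓘(ℝ, ℝ) ∞ L) (α : Fin k) {q : Q}
    {y : E × ((Fin k → ℝ) →L[ℝ] E)} (hy : y ∈ (chartT k q).target)
    (u : E × ((Fin k → ℝ) →L[ℝ] E)) :
    cartanOne L α ((chartT k q).symm y)
      (mfderiv 𝓘(ℝ, E × ((Fin k → ℝ) →L[ℝ] E)) (IT E k) (chartT k q).symm y u) =
      locP L q y u.1 α := by
  refine (cartanOne_apply hL α ((chartT k q).symm y) _).trans ?_
  rw [momenta_eq hL ((chartT k q).map_target hy), (chartT k q).right_inv hy]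
  exact congrFun (congrArg (locP L q y) (frameAt_dProj_mfderiv_symm hy u)) α

/-- This is `-d(p^α dq) = dq ∧ dp^α`. -/
theorem cartanTwo_inFibre (hL : ContMDiff (IT E k) 𝓘(ℝ, ℝ) ∞ L) (α : Fin k) (q : Q)
    (v : (Fin k → ℝ) →L[ℝ] E) (u w : E × ((Fin k → ℝ) →L[ℝ] E)) :
    cartanTwo L α (inFibre q v) u w =
      fderiv ℝ (locP L q) (extChartAt 𝓘(ℝ, E) q q, v) w u.1 α -
        fderiv ℝ (locP L q) (extChartAt 𝓘(ℝ, E) q q, v) u w.1 α := by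
  set a : E × ((Fin k → ℝ) →L[ℝ] E) := (extChartAt 𝓘(ℝ, E) q q, v) with ha
  have h1 : (fun y => (cartanOne L α ((chartT k q).symm y)).comp
      (mfderiv 𝓘(ℝ, E × ((Fin k → ℝ) →L[ℝ] E)) (IT E k) (chartT k q).symm y) :
      E × ((Fin k → ℝ) →L[ℝ] E) → E × ((Fin k → ℝ) →L[ℝ] E) →L[ℝ] ℝ) =ᶠ[𝓝 a]
      fun y => (ContinuousLinearMap.proj α).comp
        ((locP L q y).comp (ContinuousLinearMap.fst ℝ E _)) := by
    filter_upwards [(isOpen_chartT_target q).mem_nhds (chartPoint_mem_target q v)] with y hy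
    exact ContinuousLinearMap.ext fun u => cartanOne_chart hL α hy u
  have hd : HasFDerivAt (locP L q) (fderiv ℝ (locP L q) a) a :=
    ((contDiffAt_locP hL q v).differentiableAt (by simp)).hasFDerivAt
  have h2 : ∀ u w, fderiv ℝ (fun y => (ContinuousLinearMap.proj α : (Fin k → ℝ) →L[ℝ] ℝ).comp
        ((locP L q y).comp (ContinuousLinearMap.fst ℝ E ((Fin k → ℝ) →L[ℝ] E)))) a u w =
      fderiv ℝ (locP L q) a u w.1 α := by
    intro u w
    rw [((hasFDerivAt_const (ContinuousLinearMap.proj α : (Fin k → ℝ) →L[ℝ] ℝ) a).clm_comp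
      (hd.clm_comp (hasFDerivAt_const (ContinuousLinearMap.fst ℝ E ((Fin k → ℝ) →L[ℝ] E)) a))).fderiv]
    simp
  have h3 : cartanTwo L α (inFibre q v) u w = -(fderiv ℝ (fun y =>
      (cartanOne L α ((chartT k q).symm y)).comp
      (mfderiv 𝓘(ℝ, E × ((Fin k → ℝ) →L[ℝ] E)) (IT E k) (chartT k q).symm y) :
      E × ((Fin k → ℝ) →L[ℝ] E) → E × ((Fin k → ℝ) →L[ℝ] E) →L[ℝ] ℝ)
        (chartT k q (inFibre q v)) u w - fderiv ℝ (fun y =>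
      (cartanOne L α ((chartT k q).symm y)).comp
      (mfderiv 𝓘(ℝ, E × ((Fin k → ℝ) →L[ℝ] E)) (IT E k) (chartT k q).symm y) :
      E × ((Fin k → ℝ) →L[ℝ] E) → E × ((Fin k → ℝ) →L[ℝ] E) →L[ℝ] ℝ)
        (chartT k q (inFibre q v)) w u) := rfl
  rw [h3, chartT_inFibre, ← ha, h1.fderiv_eq, h2, h2]
  ring

end Differentials

/-! ### The fibre Hessian, the energy and the fibres of `FL`. -/

section AlmostRegular

set_option synthInstance.maxHeartbeats 200000

open Filter

variable {E : Type*} [NormedAddCommGroup E] [NormedSpace ℝ E]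
  {Q : Type*} [TopologicalSpace Q] [ChartedSpace E Q] [IsManifold 𝓘(ℝ, E) ∞ Q] {k : ℕ}
  {L : TkQ E Q k → ℝ}

/-- The natural pairing between `(T*_q Q)ᵏ` and `(T_q Q)ᵏ`. -/
def pair (A : E →L[ℝ] (Fin k → ℝ)) (c : (Fin k → ℝ) →L[ℝ] E) : ℝ :=
  ∑ α, A (c (Pi.single α 1)) α

variable (L) in
/-- The Legendre transformation, restricted to the fibre over `q`. -/
def fibreP (q : Q) (v : (Fin k → ℝ) →L[ℝ] E) : E →L[ℝ] (Fin k → ℝ) :=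
  locP L q (extChartAt 𝓘(ℝ, E) q q, v)

variable (L) in
/-- The differential of `locP` at a point of the fibre over `q`. -/
def dP (q : Q) (v : (Fin k → ℝ) →L[ℝ] E) :
    E × ((Fin k → ℝ) →L[ℝ] E) →L[ℝ] E →L[ℝ] (Fin k → ℝ) :=
  fderiv ℝ (locP L q) (extChartAt 𝓘(ℝ, E) q q, v)

variable (L) in
/-- The second differential of the Lagrangian at a point of the fibre over `q`, in a chart. -/
def hessL (q : Q) (v : (Fin k → ℝ) →L[ℝ] E) :
    E × ((Fin k → ℝ) →L[ℝ] E) →L[ℝ] E × ((Fin k → ℝ) →L[ℝ] E) →L[ℝ] ℝ :=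
  fderiv ℝ (fderiv ℝ (locL L q)) (extChartAt 𝓘(ℝ, E) q q, v)

theorem hasFDerivAt_fderiv_locL (hL : ContMDiff (IT E k) 𝓘(ℝ, ℝ) ∞ L)
    (q : Q) (v : (Fin k → ℝ) →L[ℝ] E) :
    HasFDerivAt (fderiv ℝ (locL L q)) (hessL L q v) (extChartAt 𝓘(ℝ, E) q q, v) :=
  (((contDiffAt_locL hL q v).fderiv_right (m := 1) (right_eq_inf.mp rfl)).differentiableAt
    one_ne_zero).hasFDerivAt

theorem hessL_symm (hL : ContMDiff (IT E k) 𝓘(ℝ, ℝ) ∞ L)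
    (q : Q) (v : (Fin k → ℝ) →L[ℝ] E) (u w : E × ((Fin k → ℝ) →L[ℝ] E)) :
    hessL L q v u w = hessL L q v w u :=
  (contDiffAt_locL hL q v).isSymmSndFDerivAt
    (by rw [minSmoothness_of_isRCLikeNormedField]; exact right_eq_inf.mp rfl) u w

theorem hasFDerivAt_locP (hL : ContMDiff (IT E k) 𝓘(ℝ, ℝ) ∞ L)
    (q : Q) (v : (Fin k → ℝ) →L[ℝ] E) :
    HasFDerivAt (locP L q) (dP L q v) (extChartAt 𝓘(ℝ, E) q q, v) :=
  ((contDiffAt_locP hL q v).differentiableAt (by simp)).hasFDerivAt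

theorem dP_apply (hL : ContMDiff (IT E k) 𝓘(ℝ, ℝ) ∞ L)
    (q : Q) (v : (Fin k → ℝ) →L[ℝ] E) (u : E × ((Fin k → ℝ) →L[ℝ] E)) (e : E)
    (α : Fin k) : dP L q v u e α = hessL L q v u (0, single α e) := by
  have h1 : HasFDerivAt (fun y => locP L q y e α)
      (((ContinuousLinearMap.proj α).comp (ContinuousLinearMap.apply ℝ (Fin k → ℝ) e)).comp
        (dP L q v)) (extChartAt 𝓘(ℝ, E) q q, v) :=
    ((ContinuousLinearMap.proj α).comp
      (ContinuousLinearMap.apply ℝ (Fin k → ℝ) e)).hasFDerivAt.comp _ (hasFDerivAt_locP hL q v)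
  have h2 := (hasFDerivAt_fderiv_locL hL q v).clm_apply
    (hasFDerivAt_const ((0, single α e) : E × ((Fin k → ℝ) →L[ℝ] E)) (extChartAt 𝓘(ℝ, E) q q, v))
  have h3 := DFunLike.congr_fun (h1.unique h2) u
  simp only [add_apply, ContinuousLinearMap.comp_apply, zero_apply, map_zero, zero_add,
    ContinuousLinearMap.flip_apply] at h3
  exact h3

theorem pair_dP (hL : ContMDiff (IT E k) 𝓘(ℝ, ℝ) ∞ L)
    (q : Q) (v : (Fin k → ℝ) →L[ℝ] E) (u : E × ((Fin k → ℝ) →L[ℝ] E))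
    (c : (Fin k → ℝ) →L[ℝ] E) : pair (dP L q v u) c = hessL L q v u (0, c) := by
  simp only [pair, dP_apply hL]
  have h : ∀ D : E × ((Fin k → ℝ) →L[ℝ] E) →L[ℝ] ℝ,
      ∑ α, D (0, single α (c (Pi.single α 1))) = D (0, c) := by
    intro D
    rw [← map_sum]
    congr 1
    ext1
    · simp [Prod.fst_sum]
    · simp [Prod.snd_sum, sum_single]
  exact h _

/-- Symmetry of the fibre Hessian: its left and right kernels agree. -/
theorem dP_eq_zero_iff (hL : ContMDiff (IT E k) 𝓘(ℝ, ℝ) ∞ L)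
    (q : Q) (v w : (Fin k → ℝ) →L[ℝ] E) :
    dP L q v (0, w) = 0 ↔ ∀ c, pair (dP L q v (0, c)) w = 0 := by
  simp only [pair_dP hL]
  constructor
  · intro h c
    rw [hessL_symm hL, ← pair_dP hL, h]
    simp [pair]
  · intro h
    ext e α
    rw [dP_apply hL, hessL_symm hL]
    exact h _

theorem contDiff_fibreP (hL : ContMDiff (IT E k) 𝓘(ℝ, ℝ) ∞ L)
    (q : Q) : ContDiff ℝ ∞ (fibreP (E := E) L q) :=
  contDiff_iff_contDiffAt.2 fun v => (contDiffAt_locP hL q v).comp (f := fun v => (_, v)) v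
    (contDiffAt_const.prodMk contDiffAt_id)

theorem fderiv_fibreP (hL : ContMDiff (IT E k) 𝓘(ℝ, ℝ) ∞ L)
    (q : Q) (v w : (Fin k → ℝ) →L[ℝ] E) :
    fderiv ℝ (fibreP L q) v w = dP L q v (0, w) :=
  DFunLike.congr_fun ((hasFDerivAt_locP hL q v).comp v (hasFDerivAt_prodMk_right _ _)).fderiv w

theorem legendre_eq_iff (hL : ContMDiff (IT E k) 𝓘(ℝ, ℝ) ∞ L)
    (q : Q) (v v' : (Fin k → ℝ) →L[ℝ] E) :
    legendre L (inFibre q v) = legendre L (inFibre q v') ↔ fibreP L q v = fibreP L q v' := by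
  rw [legendre_inFibre hL, legendre_inFibre hL]
  constructor
  · intro h
    have h2 : ∀ p p' : E →L[ℝ] (Fin k → ℝ), inFibreStar q p = inFibreStar q p' → p = p' := by
      intro p p' h
      exact eq_of_heq (TotalSpace.mk.inj h).2
    exact h2 _ _ h
  · intro h
    exact congrArg (inFibreStar q) h

/-- The differential of the energy, in a chart. -/
theorem dFun_energy_inFibre (hL : ContMDiff (IT E k) 𝓘(ℝ, ℝ) ∞ L)
    (q : Q) (v : (Fin k → ℝ) →L[ℝ] E) (u : E × ((Fin k → ℝ) →L[ℝ] E)) :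
    dFun (energy L) (inFibre q v) u =
      pair (dP L q v u) v - fderiv ℝ (locL L q) (extChartAt 𝓘(ℝ, E) q q, v) (u.1, 0) := by
  set a : E × ((Fin k → ℝ) →L[ℝ] E) := (extChartAt 𝓘(ℝ, E) q q, v) with ha
  have hd : HasFDerivAt (fun y => fderiv ℝ (locL L q) y (0, y.2) - locL L q y)
      (((fderiv ℝ (locL L q) a).comp ((0 : E × ((Fin k → ℝ) →L[ℝ] E) →L[ℝ] E).prod
        (ContinuousLinearMap.snd ℝ E _)) + (hessL L q v).flip (0, v)) - fderiv ℝ (locL L q) a) a :=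
    ((hasFDerivAt_fderiv_locL hL q v).clm_apply
      ((hasFDerivAt_const (0 : E) a).prodMk hasFDerivAt_snd)).sub
      ((contDiffAt_locL hL q v).differentiableAt (by simp)).hasFDerivAt
  have hloc : energy L ∘ (chartT k q).symm =ᶠ[𝓝 a]
      fun y => fderiv ℝ (locL L q) y (0, y.2) - locL L q y := by
    filter_upwards [(isOpen_chartT_target q).mem_nhds (chartPoint_mem_target q v)] with y hy
    exact energy_chartT_symm hL hy
  have hmd : MDifferentiableAt (IT E k) 𝓘(ℝ, ℝ) (energy L) (inFibre q v) := by
    have h1 : MDifferentiableAt (IT E k) 𝓘(ℝ, E × ((Fin k → ℝ) →L[ℝ] E)) (chartT k q)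
        (inFibre q v : TkQ E Q k) :=
      (contMDiffAt_extChartAt (I := IT E k) (n := ∞) (x := inFibre q v)).mdifferentiableAt (by simp)
    have h2 := hd.differentiableAt.mdifferentiableAt
    rw [ha, ← chartT_inFibre q v] at h2
    refine (h2.comp _ h1).congr_of_eventuallyEq ?_
    filter_upwards [extChartAt_source_mem_nhds (I := IT E k) (inFibre q v : TkQ E Q k)] with x hx
    have h3 := energy_chartT_symm hL ((chartT k q).map_source hx)
    rw [(chartT k q).left_inv hx] at h3
    exact h3
  rw [dFun_inFibre hmd, hloc.fderiv_eq, hd.fderiv, pair_dP hL]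
  have h4 : fderiv ℝ (locL L q) a u = fderiv ℝ (locL L q) a (u.1, 0) +
      fderiv ℝ (locL L q) a (0, u.2) := by
    rw [← map_add]
    simp
  simp only [sub_apply, add_apply,
    ContinuousLinearMap.comp_apply, ContinuousLinearMap.prod_apply, ContinuousLinearMap.flip_apply,
    zero_apply, ContinuousLinearMap.coe_snd', h4]
  ring

/-- Only base components and `dP` of the vectors occur, that is, their images by `TFL`. -/
theorem Omega_inFibre (hL : ContMDiff (IT E k) 𝓘(ℝ, ℝ) ∞ L)
    (q : Q) (v : (Fin k → ℝ) →L[ℝ] E) (Y : Fin k → E × ((Fin k → ℝ) →L[ℝ] E))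
    (u : E × ((Fin k → ℝ) →L[ℝ] E)) :
    Omega L (inFibre q v) Y u = ∑ α, (dP L q v u (Y α).1 α - dP L q v (Y α) u.1 α) :=
  Finset.sum_congr rfl fun α _ => cartanTwo_inFibre hL α q v (Y α) u

/-- A fibre of `FL` lies over a single point of `Q`; the fibre coordinate of the chart maps it
continuously onto the level set. -/
theorem isPreconnected_fibreP (hL : ContMDiff (IT E k) 𝓘(ℝ, ℝ) ∞ L)
    (hreg : IsAlmostRegular L) (q : Q) (p : E →L[ℝ] (Fin k → ℝ)) :
    IsPreconnected {v | fibreP L q v = p} := by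
  rcases eq_empty_or_nonempty {v | fibreP L q v = p} with h | ⟨v₀, rfl⟩
  · rw [h]
    exact isPreconnected_empty
  have h1 := (hreg.2.2 (legendre L (inFibre q v₀)) (mem_range_self _)).isPreconnected
  have hproj : ∀ x ∈ legendre L ⁻¹' {legendre L (inFibre q v₀)}, ∃ v, x = inFibre q v := by
    intro x hx
    have h2 : x.proj = q := congrArg TotalSpace.proj hx
    subst h2
    exact ⟨vel x, rfl⟩
  have h2 : {v | fibreP L q v = fibreP L q v₀} =
      (fun x => (chartT k q x).2) '' (legendre L ⁻¹' {legendre L (inFibre q v₀)}) := by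
    ext v
    constructor
    · intro hv
      exact ⟨inFibre q v, (legendre_eq_iff hL q v v₀).2 hv, congrArg Prod.snd (chartT_inFibre q v)⟩
    · rintro ⟨x, hx, rfl⟩
      obtain ⟨v, rfl⟩ := hproj x hx
      change fibreP L q (chartT k q (inFibre q v)).2 = _
      rw [chartT_inFibre]
      exact (legendre_eq_iff hL q v v₀).1 hx
  rw [h2]
  refine h1.image _ (continuous_snd.comp_continuousOn ((continuousOn_extChartAt _).mono ?_))
  intro x hx
  obtain ⟨v, rfl⟩ := hproj x hx
  exact inFibre_mem_source q v

end AlmostRegular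

/-! ### Slice charts of the image of `FL`, written in coordinates. -/

section Slice

open Filter

set_option synthInstance.maxHeartbeats 200000

variable {E : Type*} [NormedAddCommGroup E] [NormedSpace ℝ E]
  {Q : Type*} [TopologicalSpace Q] [ChartedSpace E Q] [IsManifold 𝓘(ℝ, E) ∞ Q] {k : ℕ}
  {L : TkQ E Q k → ℝ}

variable (L) in
/-- The Legendre transformation in the charts over the chart of `Q` at `q`. -/
def locFL (q : Q) (y : E × ((Fin k → ℝ) →L[ℝ] E)) : E × (E →L[ℝ] (Fin k → ℝ)) :=
  (y.1, locP L q y)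

theorem contDiffAt_locFL (hL : ContMDiff (IT E k) 𝓘(ℝ, ℝ) ∞ L) (q : Q)
    (v : (Fin k → ℝ) →L[ℝ] E) : ContDiffAt ℝ ∞ (locFL L q) (extChartAt 𝓘(ℝ, E) q q, v) :=
  contDiffAt_fst.prodMk (contDiffAt_locP hL q v)

theorem fderiv_locFL (hL : ContMDiff (IT E k) 𝓘(ℝ, ℝ) ∞ L) (q : Q)
    (v : (Fin k → ℝ) →L[ℝ] E) (u : E × ((Fin k → ℝ) →L[ℝ] E)) :
    fderiv ℝ (locFL L q) (extChartAt 𝓘(ℝ, E) q q, v) u = (u.1, dP L q v u) :=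
  DFunLike.congr_fun (hasFDerivAt_fst.prodMk (hasFDerivAt_locP hL q v)).fderiv u

/-- If `L` is almost-regular, then the Legendre transformation, written in suitable charts, is a
submersion onto a linear subspace, near all points of a fibre. -/
theorem exists_slice (hL : ContMDiff (IT E k) 𝓘(ℝ, ℝ) ∞ L) (hreg : IsAlmostRegular L) (q : Q)
    (v₀ : (Fin k → ℝ) →L[ℝ] E) :
    ∃ (ψ χ : E × (E →L[ℝ] (Fin k → ℝ)) → E × (E →L[ℝ] (Fin k → ℝ)))
      (K : Submodule ℝ (E × (E →L[ℝ] (Fin k → ℝ)))),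
      ContDiffAt ℝ 1 ψ (extChartAt 𝓘(ℝ, E) q q, fibreP L q v₀) ∧
      DifferentiableAt ℝ χ (ψ (extChartAt 𝓘(ℝ, E) q q, fibreP L q v₀)) ∧
      (∀ᶠ z in 𝓝 (extChartAt 𝓘(ℝ, E) q q, fibreP L q v₀), χ (ψ z) = z) ∧
      ∀ v, fibreP L q v = fibreP L q v₀ →
        (∀ᶠ y in 𝓝 (extChartAt 𝓘(ℝ, E) q q, v), ψ (locFL L q y) ∈ K) ∧
        ∀ c ∈ K, ∃ u, fderiv ℝ (ψ ∘ locFL L q) (extChartAt 𝓘(ℝ, E) q q, v) u = c := by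
  set x₀ : TkQ E Q k := inFibre q v₀ with hx₀
  obtain ⟨Φ, K, hΦ⟩ := hreg.1.2 (legendre L x₀) (mem_range_self x₀)
  have hFL₀ : legendre L x₀ = inFibreStar q (fibreP L q v₀) := legendre_inFibre hL q v₀
  set b : E × (E →L[ℝ] (Fin k → ℝ)) := (extChartAt 𝓘(ℝ, E) q q, fibreP L q v₀) with hb
  have hbc : chartTStar k q (legendre L x₀) = b := by
    rw [chartTStar_legendre hL (inFibre_mem_source q v₀), chartT_inFibre]
    rfl
  have hsrc : legendre L x₀ ∈ (chartTStar k q).source := by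
    rw [hFL₀]
    exact mem_extChartAt_source (I := ITStar E k) (inFibreStar q (fibreP L q v₀))
  have hbt : b ∈ (chartTStar (Q := Q) k q).target := hbc ▸ (chartTStar k q).map_source hsrc
  have hbs : (chartTStar k q).symm b = legendre L x₀ := by
    rw [← hbc]
    exact (chartTStar k q).left_inv hsrc
  have hsymm : ContMDiffAt 𝓘(ℝ, E × (E →L[ℝ] (Fin k → ℝ))) (ITStar E k) ∞
      (chartTStar (Q := Q) k q).symm b :=
    (contMDiffOn_extChartAt_symm (I := ITStar E k) _).contMDiffAt
      ((isOpen_extChartAt_target _).mem_nhds hbt)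
  have hΦs : ∀ᶠ z in 𝓝 b, (chartTStar k q).symm z ∈ Φ.source := by
    refine hsymm.continuousAt.eventually (Φ.open_source.mem_nhds ?_)
    rw [hbs]
    exact hΦ.2.1
  have hψ : ContDiffAt ℝ ∞ (Φ.extend (ITStar E k) ∘ (chartTStar k q).symm) b := by
    rw [← contMDiffAt_iff_contDiffAt]
    refine ContMDiffAt.comp b (I' := ITStar E k) ?_ hsymm
    rw [hbs]
    exact Φ.contMDiffAt_extend hΦ.1 hΦ.2.1
  have hψb : (Φ.extend (ITStar E k) ∘ (chartTStar k q).symm) b =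
      Φ.extend (ITStar E k) (legendre L x₀) := congrArg _ hbs
  refine ⟨Φ.extend (ITStar E k) ∘ (chartTStar k q).symm,
    chartTStar k q ∘ (Φ.extend (ITStar E k)).symm, K, hψ.of_le (by simp), ?_, ?_, ?_⟩
  · rw [hψb]
    refine MDifferentiableAt.differentiableAt ?_
    have h1 : MDifferentiableAt 𝓘(ℝ, E × (E →L[ℝ] (Fin k → ℝ))) (ITStar E k)
        (Φ.extend (ITStar E k)).symm (Φ.extend (ITStar E k) (legendre L x₀)) := by
      refine ((contMDiffOn_extend_symm hΦ.1).contMDiffAt ?_).mdifferentiableAt (n := ∞) (by simp)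
      rw [← Φ.extend_target']
      refine (Φ.isOpen_extend_target (I := ITStar E k)).mem_nhds
        ((Φ.extend (ITStar E k)).map_source ?_)
      rw [Φ.extend_source]
      exact hΦ.2.1
    have h2 : (Φ.extend (ITStar E k)).symm (Φ.extend (ITStar E k) (legendre L x₀)) =
      legendre L x₀ := Φ.extend_left_inv hΦ.2.1
    have h3 : MDifferentiableAt (ITStar E k) 𝓘(ℝ, E × (E →L[ℝ] (Fin k → ℝ)))
        (chartTStar k q) (legendre L x₀) := by
      rw [hFL₀]
      exact (contMDiffAt_extChartAt (I := ITStar E k) (n := ∞)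
        (x := inFibreStar q (fibreP L q v₀))).mdifferentiableAt (by simp)
    rw [← h2] at h3
    exact h3.comp _ h1
  · filter_upwards [hΦs, (isOpen_extChartAt_target _).mem_nhds hbt] with z hz hzt
    change chartTStar k q ((Φ.extend (ITStar E k)).symm
      (Φ.extend (ITStar E k) ((chartTStar k q).symm z))) = z
    rw [Φ.extend_left_inv hz]
    exact (chartTStar k q).right_inv hzt
  · intro v hv
    have hFL : legendre L (inFibre q v) = legendre L x₀ := (legendre_eq_iff hL q v v₀).2 hv
    have hlocb : locFL L q (extChartAt 𝓘(ℝ, E) q q, v) = b := by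
      rw [hb, ← hv]
      rfl
    have hc : ContinuousAt (locFL L q) (extChartAt 𝓘(ℝ, E) q q, v) :=
      (contDiffAt_locFL hL q v).continuousAt
    have hev : ∀ᶠ y in 𝓝 (extChartAt 𝓘(ℝ, E) q q, v), legendre L ((chartT k q).symm y) ∈ Φ.source ∧
        (chartTStar k q).symm (locFL L q y) = legendre L ((chartT k q).symm y) := by
      have h1 : ∀ᶠ y in 𝓝 (extChartAt 𝓘(ℝ, E) q q, v),
          legendre L ((chartT k q).symm y) ∈ Φ.source ∩ (chartTStar k q).source := by
        have h2 : ContinuousAt (legendre L ∘ (chartT k q).symm) (extChartAt 𝓘(ℝ, E) q q, v) := by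
          refine (contMDiff_legendre hL).continuous.continuousAt.comp ?_
          rw [← chartT_inFibre q v]
          exact continuousAt_extChartAt_symm (I := IT E k) (inFibre q v : TkQ E Q k)
        refine h2.eventually (IsOpen.mem_nhds (Φ.open_source.inter (isOpen_extChartAt_source _)) ?_)
        rw [Function.comp_apply, ← chartT_inFibre q v, (chartT k q).left_inv (inFibre_mem_source q v),
          hFL]
        exact ⟨hΦ.2.1, hsrc⟩
      filter_upwards [h1, (isOpen_chartT_target q).mem_nhds (chartPoint_mem_target q v)] with y hy hyt
      refine ⟨hy.1, ?_⟩
      have h3 := chartTStar_legendre hL ((chartT k q).map_target hyt)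
      rw [(chartT k q).right_inv hyt] at h3
      have h4 : locFL L q y = chartTStar k q (legendre L ((chartT k q).symm y)) := h3.symm
      rw [h4]
      exact (chartTStar k q).left_inv hy.2
    refine ⟨?_, ?_⟩
    · filter_upwards [hev] with y hy
      rw [Function.comp_apply, hy.2]
      exact (hΦ.2.2 _ hy.1).1 (mem_range_self _)
    · intro c hcK
      -- The slice chart was chosen at the image of `(q; v₀)`. It serves all points of the fibre
      -- because they have the same image, so `K` does not depend on `v`.
      obtain ⟨u, hu⟩ := hreg.2.1 (inFibre q v) Φ K (by rw [hFL]; exact hΦ) c hcK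
      refine ⟨u, ?_⟩
      have h1 : MDifferentiableAt (IT E k) 𝓘(ℝ, E × (E →L[ℝ] (Fin k → ℝ)))
          (Φ.extend (ITStar E k) ∘ legendre L) (inFibre q v) := by
        refine MDifferentiableAt.comp (I' := ITStar E k) _ ?_
          ((contMDiff_legendre hL).mdifferentiable (by simp) _)
        rw [hFL]
        exact (Φ.contMDiffAt_extend hΦ.1 hΦ.2.1).mdifferentiableAt (n := ∞) (by simp)
      have h2 := mfderiv_eq_fderiv_writtenInExtChartAt h1
      have h3 : writtenInExtChartAt (IT E k) 𝓘(ℝ, E × (E →L[ℝ] (Fin k → ℝ))) (inFibre q v)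
          (Φ.extend (ITStar E k) ∘ legendre L) =ᶠ[𝓝 (chartT k q (inFibre q v))]
          (Φ.extend (ITStar E k) ∘ (chartTStar k q).symm) ∘ locFL L q := by
        rw [chartT_inFibre]
        filter_upwards [hev] with y hy
        exact congrArg (Φ.extend (ITStar E k)) hy.2.symm
      have h4 := DFunLike.congr_fun (h2.trans h3.fderiv_eq) u
      rw [chartT_inFibre] at h4
      exact h4.symm.trans hu

end Slice

/-! ### What is constant along the fibres of `FL`. -/

section Fibres

open Filter

set_option synthInstance.maxHeartbeats 200000

variable {E : Type*} [NormedAddCommGroup E] [NormedSpace ℝ E] [FiniteDimensional ℝ E]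
  {Q : Type*} [TopologicalSpace Q] [ChartedSpace E Q] [IsManifold 𝓘(ℝ, E) ∞ Q] {k : ℕ}
  {L : TkQ E Q k → ℝ}

theorem hasFDerivAt_fderiv_apply_right {A B : Type*} [NormedAddCommGroup A] [NormedSpace ℝ A]
    [NormedAddCommGroup B] [NormedSpace ℝ B] {f : A × B → ℝ} {D : A × B →L[ℝ] A × B →L[ℝ] ℝ}
    {a : A} {b : B} (h : HasFDerivAt (fderiv ℝ f) D (a, b)) (u : A × B) :
    HasFDerivAt (fun y => fderiv ℝ f (a, y) u)
      ((D.comp (ContinuousLinearMap.inr ℝ A B)).flip u) b := by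
  have h1 : HasFDerivAt (fun y => fderiv ℝ f (a, y)) (D.comp (ContinuousLinearMap.inr ℝ A B)) b :=
    h.comp b (hasFDerivAt_prodMk_right a b)
  simpa using h1.clm_apply (hasFDerivAt_const u b)

/-- Near `x`, `f` equals its composition with a projection onto `K`, hence so does its differential.
-/
theorem fderiv_mem_of_eventually_mem {X Y : Type*} [NormedAddCommGroup X] [NormedSpace ℝ X]
    [NormedAddCommGroup Y] [NormedSpace ℝ Y] [FiniteDimensional ℝ Y] {K : Submodule ℝ Y}
    {f : X → Y} {x : X} (hf : DifferentiableAt ℝ f x) (hK : ∀ᶠ y in 𝓝 x, f y ∈ K) (u : X) :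
    fderiv ℝ f x u ∈ K := by
  obtain ⟨pr, hpr⟩ := Submodule.ClosedComplemented.of_finiteDimensional (𝕜 := ℝ) K
  have h1 : f =ᶠ[𝓝 x] fun y => (K.subtypeL.comp pr) (f y) := by
    filter_upwards [hK] with y hy
    exact (congrArg Subtype.val (hpr ⟨f y, hy⟩)).symm
  have h2 := (K.subtypeL.comp pr).hasFDerivAt.comp x hf.hasFDerivAt
  have h3 := h1.fderiv_eq.trans h2.fderiv
  rw [h3]
  exact (pr (fderiv ℝ f x u)).2

/-- The image of the differential of the Legendre transformation is the same at all the points of a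
fibre. -/
theorem exists_same_dLegendre (hL : ContMDiff (IT E k) 𝓘(ℝ, ℝ) ∞ L) (hreg : IsAlmostRegular L)
    {q : Q} {v v' : (Fin k → ℝ) →L[ℝ] E} (h : fibreP L q v' = fibreP L q v)
    (u : E × ((Fin k → ℝ) →L[ℝ] E)) : ∃ u' : E × ((Fin k → ℝ) →L[ℝ] E),
      u'.1 = u.1 ∧ dP L q v' u' = dP L q v u := by
  obtain ⟨ψ, χ, K, hψ, hχ, hχψ, hK⟩ := exists_slice hL hreg q v
  set b : E × (E →L[ℝ] (Fin k → ℝ)) := (extChartAt 𝓘(ℝ, E) q q, fibreP L q v) with hb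
  have hψd : DifferentiableAt ℝ ψ b := hψ.differentiableAt one_ne_zero
  have hcomp : ∀ w, fibreP L q w = fibreP L q v → ∀ u,
      fderiv ℝ (ψ ∘ locFL L q) (extChartAt 𝓘(ℝ, E) q q, w) u =
        fderiv ℝ ψ b (u.1, dP L q w u) := by
    intro w hw u
    have h1 : locFL L q (extChartAt 𝓘(ℝ, E) q q, w) = b := congrArg (Prod.mk _) hw
    rw [fderiv_comp _ (h1 ▸ hψd) ((contDiffAt_locFL hL q w).differentiableAt (by simp)), h1,
      ContinuousLinearMap.comp_apply, fderiv_locFL hL]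
  have hinj : ∀ z z', fderiv ℝ ψ b z = fderiv ℝ ψ b z' → z = z' := by
    intro z z' hzz
    have h1 : (fderiv ℝ χ (ψ b)).comp (fderiv ℝ ψ b) = ContinuousLinearMap.id ℝ _ := by
      have h2 : χ ∘ ψ =ᶠ[𝓝 b] id := hχψ
      rw [← fderiv_comp _ hχ hψd, h2.fderiv_eq, fderiv_id]
    have h2 := congrArg (fderiv ℝ χ (ψ b)) hzz
    exact (DFunLike.congr_fun h1 z).symm.trans (h2.trans (DFunLike.congr_fun h1 z'))
  -- The differential of `ψ ∘ locFL` lands in `K` at `v` and covers `K` at `v'`; the differential of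
  -- `ψ`, taken at the common image point, is injective.
  have hmem : fderiv ℝ (ψ ∘ locFL L q) (extChartAt 𝓘(ℝ, E) q q, v) u ∈ K := by
    refine fderiv_mem_of_eventually_mem ?_ (hK v rfl).1 u
    exact DifferentiableAt.comp _ hψd ((contDiffAt_locFL hL q v).differentiableAt (by simp))
  obtain ⟨u', hu'⟩ := (hK v' h).2 _ hmem
  rw [hcomp v' h, hcomp v rfl] at hu'
  have h3 := hinj _ _ hu'
  exact ⟨u', (Prod.ext_iff.1 h3).1, (Prod.ext_iff.1 h3).2⟩

theorem hasRetractions_fibreP (hL : ContMDiff (IT E k) 𝓘(ℝ, ℝ) ∞ L) (hreg : IsAlmostRegular L)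
    (q : Q) (p : E →L[ℝ] (Fin k → ℝ)) : HasRetractions (fibreP L q) p := by
  rintro v₀ rfl
  obtain ⟨ψ, χ, K, hψ, -, hχψ, hK⟩ := exists_slice hL hreg q v₀
  have : CompleteSpace (E × ((Fin k → ℝ) →L[ℝ] E)) := FiniteDimensional.complete ℝ _
  obtain ⟨r, hr, hrF, hrid, C, hC⟩ := exists_retraction (G := locFL L q) (ψ := ψ)
    (x₀ := (extChartAt 𝓘(ℝ, E) q q, v₀)) ((contDiffAt_locFL hL q v₀).of_le (by simp)) hψ hχψ
    (fun z hz z' hz' h => by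
      have h1 : χ (ψ z) = z := hz
      have h2 : χ (ψ z') = z' := hz'
      rw [← h1, ← h2, h]) K (hK v₀ rfl).1 (hK v₀ rfl).2
  have hι : ContDiff ℝ 1 (fun v : (Fin k → ℝ) →L[ℝ] E => (extChartAt 𝓘(ℝ, E) q q, v)) :=
    contDiff_const.prodMk contDiff_id
  have ht := hι.continuous.tendsto v₀
  -- `locFL` includes the base coordinate, so the retracted points stay over `q` and their second
  -- component suffices.
  refine ⟨fun v => (r (extChartAt 𝓘(ℝ, E) q q, v)).2,
    contDiffAt_snd.comp v₀ (hr.comp v₀ hι.contDiffAt), ?_, ?_, C, ?_⟩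
  · filter_upwards [ht.eventually hrF] with v hv
    have h1 : (r (extChartAt 𝓘(ℝ, E) q q, v)).1 = extChartAt 𝓘(ℝ, E) q q := congrArg Prod.fst hv
    have h2 : locP L q (r (extChartAt 𝓘(ℝ, E) q q, v)) = fibreP L q v₀ := congrArg Prod.snd hv
    rw [← h2, fibreP]
    congr 1
    exact Prod.ext h1.symm rfl
  · filter_upwards [ht.eventually hrid] with v hv h
    exact congrArg Prod.snd (hv (congrArg (Prod.mk _) h))
  · filter_upwards [ht.eventually hC] with v hv
    have h1 : ‖locFL L q (extChartAt 𝓘(ℝ, E) q q, v) - locFL L q (extChartAt 𝓘(ℝ, E) q q, v₀)‖ =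
        ‖fibreP L q v - fibreP L q v₀‖ := by
      have h2 : locFL L q (extChartAt 𝓘(ℝ, E) q q, v) -
        locFL L q (extChartAt 𝓘(ℝ, E) q q, v₀) = (0, fibreP L q v - fibreP L q v₀) :=
        Prod.ext (sub_self _) rfl
      rw [h2, Prod.norm_def, norm_zero, max_eq_right (norm_nonneg _)]
    rw [h1] at hv
    exact (norm_snd_le (r (extChartAt 𝓘(ℝ, E) q q, v) - (extChartAt 𝓘(ℝ, E) q q, v))).trans hv

/-- The differential of the energy is the pull-back of a `1`-form by the Legendre
transformation. -/
theorem dFun_energy_eq (hL : ContMDiff (IT E k) 𝓘(ℝ, ℝ) ∞ L) (hreg : IsAlmostRegular L)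
    {q : Q} {v v' : (Fin k → ℝ) →L[ℝ] E} (h : fibreP L q v' = fibreP L q v)
    {u u' : E × ((Fin k → ℝ) →L[ℝ] E)} (h1 : u'.1 = u.1) (h2 : dP L q v' u' = dP L q v u) :
    dFun (energy L) (inFibre q v') u' = dFun (energy L) (inFibre q v) u := by
  rw [dFun_energy_inFibre hL, dFun_energy_inFibre hL, h1, h2]
  set mo := dP L q v u with hmo
  set z := u.1 with hz
  -- With `TFL` of the argument frozen to `(z, mo)`, the differential of the energy is a function
  -- `R` of the point alone. It remains to show that `R` is constant on the connected level set.
  set R : ((Fin k → ℝ) →L[ℝ] E) → ℝ := fun b =>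
    pair mo b - fderiv ℝ (locL L q) (extChartAt 𝓘(ℝ, E) q q, b) (z, 0) with hR
  have hRd : ∀ b, ∃ D : ((Fin k → ℝ) →L[ℝ] E) →L[ℝ] ℝ, HasFDerivAt R D b ∧
      ∀ w, D w = pair mo w - hessL L q b (0, w) (z, 0) := by
    intro b
    have h3 : HasFDerivAt (fun b => ∑ α, mo (b (Pi.single α 1)) α)
        (∑ α, ((ContinuousLinearMap.proj α : (Fin k → ℝ) →L[ℝ] ℝ).comp mo).comp
          (ContinuousLinearMap.apply ℝ E (Pi.single α 1 : Fin k → ℝ))) b := by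
      refine HasFDerivAt.fun_sum fun α _ => ?_
      exact (((ContinuousLinearMap.proj α : (Fin k → ℝ) →L[ℝ] ℝ).comp mo).comp
          (ContinuousLinearMap.apply ℝ E (Pi.single α 1 : Fin k → ℝ))).hasFDerivAt
    have h4 := hasFDerivAt_fderiv_apply_right (hasFDerivAt_fderiv_locL hL q b) (z, 0)
    refine ⟨_, h3.sub h4, fun w => ?_⟩
    simp only [sub_apply, sum_apply, ContinuousLinearMap.comp_apply,
      ContinuousLinearMap.flip_apply, ContinuousLinearMap.inr_apply, pair]
    rfl
  refine eq_of_fderiv_eq_zero_on_level (H := fibreP L q) (p := fibreP L q v) (R := R)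
    ((contDiff_fibreP hL q).differentiable (by simp)) (hasRetractions_fibreP hL hreg q _)
    (isPreconnected_fibreP hL hreg q _) (fun b => ?_) (fun b w hb hw => ?_) h rfl
  · obtain ⟨D, hD, -⟩ := hRd b
    exact hD.differentiableAt
  · obtain ⟨D, hD, hDw⟩ := hRd b
    rw [hD.fderiv, hDw]
    -- Lifting `(z, mo)` to a vector `(z, c)` at `b` turns `pair mo w` into the Hessian of `(z, c)`
    -- and `(0, w)`. The contribution of `c` vanishes since `w` is in the kernel, and that of `z`
    -- cancels the other term of `dR`.
    obtain ⟨⟨z', c⟩, h5, h6⟩ := exists_same_dLegendre hL hreg hb u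
    simp only at h5
    subst h5
    rw [fderiv_fibreP hL] at hw
    have h7 : ((z, c) : E × ((Fin k → ℝ) →L[ℝ] E)) = (z, 0) + (0, c) := by simp
    have h8 : hessL L q b (0, c) (0, w) = 0 := by
      rw [hessL_symm hL, ← pair_dP hL, hw]
      simp [pair]
    have h9 : hessL L q b (z, c) (0, w) = hessL L q b (z, 0) (0, w) + hessL L q b (0, c) (0, w) := by
      rw [h7, map_add, add_apply]
    rw [hmo, ← h6, pair_dP hL, h9, h8, add_zero, hessL_symm hL q b (z, 0), sub_self]

end Fibres

/-! ### Vertical vectors extend to smooth vertical fields, so `𝔐` can be tested pointwise. -/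

section VerticalFields

open Filter

set_option synthInstance.maxHeartbeats 200000

variable {E : Type*} [NormedAddCommGroup E] [NormedSpace ℝ E]
  {Q : Type*} [TopologicalSpace Q] [ChartedSpace E Q] [IsManifold 𝓘(ℝ, E) ∞ Q] {k : ℕ}

theorem isManifold_TkQ_one : IsManifold (IT E k) 1 (TkQ E Q k) :=
  IsManifold.of_le (n := ∞) (by simp)

/-- The inverse of the differential at `x` of the chart of `T¹ₖQ` over the chart of `Q` at `q`. -/
def coordFrame (q : Q) (x : TkQ E Q k) :
    E × ((Fin k → ℝ) →L[ℝ] E) →L[ℝ] E × ((Fin k → ℝ) →L[ℝ] E) :=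
  (trivializationAt (E × ((Fin k → ℝ) →L[ℝ] E)) (TangentSpace (IT E k))
    (inFibre q 0 : TkQ E Q k)).symmL ℝ x

theorem coordFrame_eq {q : Q} {x : TkQ E Q k} (hx : x ∈ (chartT k q).source) :
    coordFrame q x = (mfderiv 𝓘(ℝ, E × ((Fin k → ℝ) →L[ℝ] E)) (IT E k) (chartT k q).symm
      (chartT k q x) : E × ((Fin k → ℝ) →L[ℝ] E) →L[ℝ] E × ((Fin k → ℝ) →L[ℝ] E)) := by
  have hman := isManifold_TkQ_one (E := E) (Q := Q) (k := k)
  have h1 := TangentBundle.symmL_trivializationAt (I := IT E k) (𝕜 := ℝ)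
    (x₀ := (inFibre q 0 : TkQ E Q k)) (x := x) (by rwa [← extChartAt_source (IT E k)])
  have h2 : range (IT E k) = univ := ModelWithCorners.range_eq_univ _
  rw [h2, mfderivWithin_univ] at h1
  exact h1

theorem dProj_coordFrame {q : Q} {x : TkQ E Q k} (hx : x ∈ (chartT k q).source)
    (w : (Fin k → ℝ) →L[ℝ] E) : dProj x (coordFrame q x (0, w)) = 0 := by
  have h1 := frameAt_dProj_mfderiv_symm ((chartT k q).map_source hx) (0, w)
  have h2 := congrArg (fun D : E × ((Fin k → ℝ) →L[ℝ] E) →L[ℝ] E × ((Fin k → ℝ) →L[ℝ] E) =>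
    frameAt (E := E) q x.proj (dProj x (D (0, w)) : E)) (coordFrame_eq hx)
  have h3 : frameAt (E := E) q x.proj (dProj x (coordFrame q x (0, w)) : E) = 0 := by
    refine h2.trans ?_
    rw [(chartT k q).left_inv hx] at h1
    exact h1
  have h4 := Trivialization.symmL_continuousLinearMapAt
    (trivializationAt E (TangentSpace 𝓘(ℝ, E)) q) (R := ℝ) (b := x.proj)
    (by rw [chartT_source] at hx; exact hx) (dProj x (coordFrame q x (0, w)))
  refine h4.symm.trans ?_
  refine (congrArg _ h3).trans ?_
  exact ContinuousLinearMap.map_zero _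

theorem trivializationAt_coordFrame {q : Q} {x : TkQ E Q k} (hx : x ∈ (chartT k q).source)
    (u : E × ((Fin k → ℝ) →L[ℝ] E)) :
    (trivializationAt (E × ((Fin k → ℝ) →L[ℝ] E)) (TangentSpace (IT E k))
      (inFibre q 0 : TkQ E Q k) ⟨x, coordFrame q x u⟩).2 = u := by
  rw [chartT, extChartAt_source] at hx
  have h := congrArg Prod.snd ((trivializationAt (E × ((Fin k → ℝ) →L[ℝ] E))
    (TangentSpace (IT E k)) (inFibre q 0 : TkQ E Q k)).apply_mk_symm (b := x) hx u)
  have h' := (trivializationAt (E × ((Fin k → ℝ) →L[ℝ] E))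
    (TangentSpace (IT E k)) (inFibre q 0 : TkQ E Q k)).symmL_apply (R := ℝ) (b := x) hx u
  refine Eq.trans (congrArg (fun u : E × ((Fin k → ℝ) →L[ℝ] E) =>
    (trivializationAt (E × ((Fin k → ℝ) →L[ℝ] E)) (TangentSpace (IT E k))
      (inFibre q 0 : TkQ E Q k) ⟨x, u⟩).2) h') h

theorem coordFrame_inFibre (q : Q) (v : (Fin k → ℝ) →L[ℝ] E) :
    coordFrame q (inFibre q v) = ContinuousLinearMap.id ℝ _ := by
  have hman := isManifold_TkQ_one (E := E) (Q := Q) (k := k)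
  have h1 := mfderivWithin_range_extChartAt_symm (I := IT E k) (x := (inFibre q v : TkQ E Q k))
  have h2 : range (IT E k) = univ := ModelWithCorners.range_eq_univ _
  rw [h2, mfderivWithin_univ] at h1
  exact (coordFrame_eq (inFibre_mem_source q v)).trans h1

variable [FiniteDimensional ℝ E] [T2Space Q] {L : TkQ E Q k → ℝ}

/-- Every vertical vector extends to a smooth vertical vector field. -/
theorem exists_smooth_vertical_extension (q : Q) (v w : (Fin k → ℝ) →L[ℝ] E) :
    ∃ Y : VF E Q k, IsSmoothVectorField (IT E k) Y ∧ (∀ x, dProj x (Y x) = 0) ∧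
      Y (inFibre q v) = ((0, w) : E × ((Fin k → ℝ) →L[ℝ] E)) := by
  have hman := isManifold_TkQ_one (E := E) (Q := Q) (k := k)
  -- The cut-off is a bump function on `Q` pulled back by `π`: it is `1` on the whole fibre over `q`
  -- and vanishes near all points outside the chart domain.
  obtain ⟨f⟩ : Nonempty (SmoothBumpFunction 𝓘(ℝ, E) q) := inferInstance
  have hsupp : ∀ x : TkQ E Q k, x ∉ (chartT k q).source → x.proj ∉ tsupport f := by
    intro x hx h
    apply hx
    rw [chartT_source]
    exact f.tsupport_subset_chartAt_source h
  set Y : TkQ E Q k → E × ((Fin k → ℝ) →L[ℝ] E) :=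
    fun x => f x.proj • coordFrame q x (0, w) with hY
  refine ⟨fun x => Y x, ?_, ?_, ?_⟩
  · intro x
    by_cases hx : x ∈ (chartT (E := E) (Q := Q) k q).source
    · have hx' : x ∈ (trivializationAt (E × ((Fin k → ℝ) →L[ℝ] E)) (TangentSpace (IT E k))
          (inFibre q 0 : TkQ E Q k)).baseSet := by
        have h := hx
        rw [chartT, extChartAt_source] at h
        exact h
      refine ((trivializationAt (E × ((Fin k → ℝ) →L[ℝ] E)) (TangentSpace (IT E k))
        (inFibre q 0 : TkQ E Q k)).contMDiffAt_section_iff hx').2 ?_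
      have h2 : ContMDiffAt (IT E k) 𝓘(ℝ, E × ((Fin k → ℝ) →L[ℝ] E)) ∞
          (fun y : TkQ E Q k => f y.proj • ((0, w) : E × ((Fin k → ℝ) →L[ℝ] E))) x :=
        (f.contMDiffAt.comp x (contMDiff_proj_TkQ x)).smul contMDiffAt_const
      refine h2.congr_of_eventuallyEq ?_
      filter_upwards [(isOpen_extChartAt_source (I := IT E k)
        (inFibre q 0 : TkQ E Q k)).mem_nhds hx] with y hy
      refine Eq.trans ?_ (trivializationAt_coordFrame hy (f y.proj • (0, w)))
      exact congrArg (fun u : E × ((Fin k → ℝ) →L[ℝ] E) =>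
        (trivializationAt (E × ((Fin k → ℝ) →L[ℝ] E)) (TangentSpace (IT E k))
          (inFibre q 0 : TkQ E Q k) ⟨y, u⟩).2) (map_smul (coordFrame q y) _ _).symm
    · have h2 : (fun x : TkQ E Q k => (⟨x, Y x⟩ : TangentBundle (IT E k) (TkQ E Q k))) =ᶠ[𝓝 x]
          zeroSection (E × ((Fin k → ℝ) →L[ℝ] E)) (TangentSpace (IT E k)) := by
        have h3 : ∀ᶠ y : TkQ E Q k in 𝓝 x, y.proj ∈ (tsupport f)ᶜ :=
          (contMDiff_proj_TkQ (E := E) (Q := Q) (k := k)).continuous.continuousAt.eventually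
            ((isClosed_tsupport f).isOpen_compl.mem_nhds (hsupp x hx))
        filter_upwards [h3] with y hy
        have h4 : Y y = 0 := by
          rw [hY]
          simp only [image_eq_zero_of_notMem_tsupport hy, zero_smul]
        exact congrArg (fun u : E × ((Fin k → ℝ) →L[ℝ] E) =>
          (⟨y, u⟩ : TangentBundle (IT E k) (TkQ E Q k))) h4
      exact (contMDiff_zeroSection ℝ _ x).congr_of_eventuallyEq h2
  · intro x
    have hlin : ∀ (D : E × ((Fin k → ℝ) →L[ℝ] E) →L[ℝ] E) (c : ℝ) u, D u = 0 → D (c • u) = 0 := by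
      intro D c u h
      rw [map_smul, h, smul_zero]
    by_cases hx : x ∈ (chartT (E := E) (Q := Q) k q).source
    · exact hlin (dProj x) _ _ (dProj_coordFrame hx w)
    · have h4 : Y x = 0 := by
        rw [hY]
        simp only [image_eq_zero_of_notMem_tsupport (hsupp x hx), zero_smul]
      exact (hlin (dProj x) 0 0 (map_zero _)) ▸ congrArg (dProj x) (h4.trans (zero_smul ℝ 0).symm)
  · change f q • coordFrame q (inFibre q v) (0, w) = _
    rw [f.eq_one, one_smul, coordFrame_inFibre]
    rfl

/-- The vectors of `𝔐` are `Ω_L`-orthogonal to all the tuples of vertical vectors. -/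
theorem Omega_eq_zero_of_mem_frakM {Z : VF E Q k}
    (hZ : Z ∈ frakM L) (q : Q) (v : (Fin k → ℝ) →L[ℝ] E)
    (w : Fin k → (Fin k → ℝ) →L[ℝ] E) :
    Omega L (inFibre q v) (fun α => ((0, w α) : E × ((Fin k → ℝ) →L[ℝ] E))) (Z (inFibre q v)) =
      0 := by
  choose Y hY hYv hYw using fun α => exists_smooth_vertical_extension q v (w α)
  have h := hZ.2 Y ⟨hY, hYv⟩ (inFibre q v)
  simp only [hYw] at h
  exact h

end VerticalFields

/-! ### Centres of the fibres, and the constraint functions along them. -/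

section Constraints

open Filter

set_option synthInstance.maxHeartbeats 200000

variable {E : Type*} [NormedAddCommGroup E] [NormedSpace ℝ E]
  {Q : Type*} [TopologicalSpace Q] [ChartedSpace E Q] [IsManifold 𝓘(ℝ, E) ∞ Q] {k : ℕ}
  {L : TkQ E Q k → ℝ}

theorem pair_add_right (A : E →L[ℝ] (Fin k → ℝ)) (c d : (Fin k → ℝ) →L[ℝ] E) :
    pair A (c + d) = pair A c + pair A d := by
  simp [pair, Finset.sum_add_distrib]

theorem pair_smul_right (A : E →L[ℝ] (Fin k → ℝ)) (t : ℝ) (c : (Fin k → ℝ) →L[ℝ] E) :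
    pair A (t • c) = t * pair A c := by
  simp [pair, Finset.mul_sum]

theorem Omega_add (hL : ContMDiff (IT E k) 𝓘(ℝ, ℝ) ∞ L) (q : Q) (v : (Fin k → ℝ) →L[ℝ] E)
    (Y Y' : Fin k → E × ((Fin k → ℝ) →L[ℝ] E)) (z : E × ((Fin k → ℝ) →L[ℝ] E)) :
    Omega L (inFibre q v) (fun α => Y α + Y' α) z =
      Omega L (inFibre q v) Y z + Omega L (inFibre q v) Y' z := by
  refine (Omega_inFibre hL q v _ z).trans ?_
  rw [Omega_inFibre hL, Omega_inFibre hL, ← Finset.sum_add_distrib]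
  refine Finset.sum_congr rfl fun α _ => ?_
  simp only [Prod.fst_add, map_add, add_apply, Pi.add_apply]
  ring

theorem Omega_sub (hL : ContMDiff (IT E k) 𝓘(ℝ, ℝ) ∞ L) (q : Q) (v : (Fin k → ℝ) →L[ℝ] E)
    (Y Y' : Fin k → E × ((Fin k → ℝ) →L[ℝ] E)) (z : E × ((Fin k → ℝ) →L[ℝ] E)) :
    Omega L (inFibre q v) (fun α => Y α - Y' α) z =
      Omega L (inFibre q v) Y z - Omega L (inFibre q v) Y' z := by
  have h := Omega_add hL q v (fun α => Y α - Y' α) Y' z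
  simp only [sub_add_cancel] at h
  exact eq_sub_of_add_eq h.symm

theorem apply_sum_single (e : Fin k → E) (β : Fin k) :
    (∑ α, single (E := E) α (e α)) (Pi.single β 1) = e β := by
  have : ∀ α, single (E := E) α (e α) (Pi.single β 1) = if α = β then e α else 0 := by
    intro α
    change (Pi.single β (1 : ℝ) : Fin k → ℝ) α • e α = _
    by_cases h : α = β
    · subst h; simp
    · simp [h]
  rw [sum_apply]
  simp [this]

theorem legendre_eq_of_fibreP_eq (hL : ContMDiff (IT E k) 𝓘(ℝ, ℝ) ∞ L) {x : TkQ E Q k}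
    {u : (Fin k → ℝ) →L[ℝ] E} (h : fibreP L x.proj u = fibreP L x.proj (vel x)) :
    legendre L (inFibre x.proj u) = legendre L x :=
  (legendre_eq_iff hL x.proj u (vel x)).2 h

/-- The base components of a solution at a point of a fibre of the Legendre transformation form a
centre of this fibre. -/
theorem fderiv_fibreP_sub_eq_zero (hL : ContMDiff (IT E k) 𝓘(ℝ, ℝ) ∞ L)
    {q : Q} {v : (Fin k → ℝ) →L[ℝ] E} {Y : Fin k → E × ((Fin k → ℝ) →L[ℝ] E)}
    (hY : ∀ z, Omega L (inFibre q v) Y z = dFun (energy L) (inFibre q v) z)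
    {u : (Fin k → ℝ) →L[ℝ] E} (hu : ∀ α, u (Pi.single α 1) = (Y α).1) :
    fderiv ℝ (fibreP L q) v (u - v) = 0 := by
  rw [fderiv_fibreP hL, dP_eq_zero_iff hL]
  intro c
  have h1 := (Omega_inFibre hL q v Y (0, c)).symm.trans
    ((hY (0, c)).trans (dFun_energy_inFibre hL q v (0, c)))
  have h2 : pair (dP L q v (0, c)) u = pair (dP L q v (0, c)) v := by
    have h4 : ((0, 0) : E × ((Fin k → ℝ) →L[ℝ] E)) = 0 := rfl
    simpa [pair, hu, h4] using h1
  have h3 := pair_add_right (dP L q v (0, c)) (u - v) v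
  rw [sub_add_cancel] at h3
  linarith

/-- Tuples with equal base components differ by a vertical tuple, which `z` does not detect. -/
theorem Omega_eq_of_vertical (hL : ContMDiff (IT E k) 𝓘(ℝ, ℝ) ∞ L) (q : Q)
    (v : (Fin k → ℝ) →L[ℝ] E) (Y Y' : Fin k → E × ((Fin k → ℝ) →L[ℝ] E))
    (h : ∀ α, (Y α).1 = (Y' α).1) {z : E × ((Fin k → ℝ) →L[ℝ] E)}
    (hz : ∀ w : Fin k → (Fin k → ℝ) →L[ℝ] E, Omega L (inFibre q v)
      (fun α => ((0, w α) : E × ((Fin k → ℝ) →L[ℝ] E))) z = 0) :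
    Omega L (inFibre q v) Y z = Omega L (inFibre q v) Y' z := by
  rw [← sub_eq_zero]
  refine (Omega_sub hL q v Y Y' z).symm.trans (Eq.trans ?_ (hz fun α => (Y α - Y' α).2))
  refine congrArg (fun T : Fin k → E × ((Fin k → ℝ) →L[ℝ] E) => Omega L (inFibre q v) T z) ?_
  funext α
  exact Prod.ext (sub_eq_zero.2 (h α)) rfl

theorem eta_inFibre (hL : ContMDiff (IT E k) 𝓘(ℝ, ℝ) ∞ L) {X : KVF E Q k}
    (hX : IsLagrangianOn L X (P1 L)) (Γ : KVF E Q k) (Z : VF E Q k) {q : Q}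
    {v : (Fin k → ℝ) →L[ℝ] E} (hv : inFibre q v ∈ P1 L) :
    eta L Γ X Z (inFibre q v) = Omega L (inFibre q v) (fun α => Γ α (inFibre q v))
      (Z (inFibre q v)) - dFun (energy L) (inFibre q v) (Z (inFibre q v)) :=
  (Omega_sub hL q v (fun α => Γ α (inFibre q v)) (fun α => X α (inFibre q v)) _).trans
    (congrArg _ (hX _ hv _))

theorem fst_of_isSOPDE {Γ : KVF E Q k} (hΓ : IsSOPDE Γ) (α : Fin k) (q : Q)
    (v : (Fin k → ℝ) →L[ℝ] E) :
    (Γ α (inFibre q v) : E × ((Fin k → ℝ) →L[ℝ] E)).1 = v (Pi.single α 1) :=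
  (dProj_inFibre q v _).symm.trans (hΓ α (inFibre q v))

theorem dP_vertical_eq_zero (hL : ContMDiff (IT E k) 𝓘(ℝ, ℝ) ∞ L) {q : Q}
    {v : (Fin k → ℝ) →L[ℝ] E} {z : E × ((Fin k → ℝ) →L[ℝ] E)}
    (hz : ∀ w : Fin k → (Fin k → ℝ) →L[ℝ] E, Omega L (inFibre q v)
      (fun α => ((0, w α) : E × ((Fin k → ℝ) →L[ℝ] E))) z = 0)
    (c : (Fin k → ℝ) →L[ℝ] E) (α : Fin k) : dP L q v (0, c) z.1 α = 0 := by
  -- Testing with a tuple supported in the place `α` isolates one summand.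
  have h := (Omega_inFibre hL q v _ z).symm.trans (hz (Pi.single α c))
  have h0 : ((0, 0) : E × ((Fin k → ℝ) →L[ℝ] E)) = 0 := rfl
  rw [Finset.sum_eq_single α] at h
  · simpa using h
  · intro β _ hβ
    simp [Pi.single_eq_of_ne hβ, h0]
  · simp

/-- The linear part of the constraint defined by the vector `z`, on the fibre of `FL` through
`(q; v)`. -/
def linPart (L : TkQ E Q k → ℝ) (q : Q) (v : (Fin k → ℝ) →L[ℝ] E)
    (z : E × ((Fin k → ℝ) →L[ℝ] E)) (y : (Fin k → ℝ) →L[ℝ] E) : ℝ :=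
  pair (dP L q v z) y - ∑ α, dP L q v (y (Pi.single α 1), 0) z.1 α

theorem linPart_add (q : Q) (v : (Fin k → ℝ) →L[ℝ] E) (z : E × ((Fin k → ℝ) →L[ℝ] E))
    (y y' : (Fin k → ℝ) →L[ℝ] E) :
    linPart L q v z (y + y') = linPart L q v z y + linPart L q v z y' := by
  have h : ∀ a b : E, ((a + b, 0) : E × ((Fin k → ℝ) →L[ℝ] E)) = (a, 0) + (b, 0) := by simp
  simp only [linPart, pair_add_right, add_apply, h, map_add, Pi.add_apply, Finset.sum_add_distrib]
  ring

theorem linPart_smul (q : Q) (v : (Fin k → ℝ) →L[ℝ] E) (z : E × ((Fin k → ℝ) →L[ℝ] E)) (t : ℝ)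
    (y : (Fin k → ℝ) →L[ℝ] E) : linPart L q v z (t • y) = t * linPart L q v z y := by
  have h : ∀ a : E, ((t • a, 0) : E × ((Fin k → ℝ) →L[ℝ] E)) = t • (a, 0) := by simp
  simp only [linPart, pair_smul_right, smul_apply, h, map_smul, Pi.smul_apply, smul_eq_mul,
    ← Finset.mul_sum]
  ring

/-- Finite-dimensional duality: a subspace of the dual equals its double annihilator. -/
theorem mem_range_of_forall_eq_zero {K W : Type*} [Field K] [AddCommGroup W] [Module K W]
    [FiniteDimensional K W] (f : W →ₗ[K] Module.Dual K W) (β : Module.Dual K W)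
    (h : ∀ w, (∀ c, f c w = 0) → β w = 0) : ∃ c, f c = β := by
  have h1 := Subspace.dualCoannihilator_dualAnnihilator_eq (W := LinearMap.range f)
  have h2 : β ∈ (LinearMap.range f).dualCoannihilator.dualAnnihilator := by
    rw [Submodule.mem_dualAnnihilator]
    intro w hw
    rw [Submodule.mem_dualCoannihilator] at hw
    exact h w fun c => hw _ ⟨c, rfl⟩
  rw [h1] at h2
  exact h2

/-- The differential of `FL` sends an `FL`-projectable vector field to the same vector at all the
points of a fibre of `FL`. -/
theorem same_dLegendre_of_isProjectableVF (hL : ContMDiff (IT E k) 𝓘(ℝ, ℝ) ∞ L) {Z : VF E Q k}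
    (hZ : IsProjectableVF L Z) {q : Q} {v b : (Fin k → ℝ) →L[ℝ] E}
    (h : fibreP L q b = fibreP L q v) :
    (Z (inFibre q b) : E × ((Fin k → ℝ) →L[ℝ] E)).1 =
        (Z (inFibre q v) : E × ((Fin k → ℝ) →L[ℝ] E)).1 ∧
      dP L q b (Z (inFibre q b)) = dP L q v (Z (inFibre q v)) := by
  obtain ⟨Z₀, hZ₀⟩ := hZ
  have h1 : ∀ b, ((Z (inFibre q b) : E × ((Fin k → ℝ) →L[ℝ] E)).1, dP L q b (Z (inFibre q b))) =
      (Z₀ (legendre L (inFibre q b)) : E × (E →L[ℝ] (Fin k → ℝ))) := fun b =>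
    (dLegendre_inFibre hL q b _).symm.trans (hZ₀ (inFibre q b))
  have h2 : ∀ p p' : TkStarQ E Q k, p = p' →
      (Z₀ p : E × (E →L[ℝ] (Fin k → ℝ))) = (Z₀ p' : E × (E →L[ℝ] (Fin k → ℝ))) := by
    rintro p _ rfl
    rfl
  exact Prod.ext_iff.1 ((h1 b).trans ((h2 _ _ ((legendre_eq_iff hL q b v).2 h)).trans (h1 v).symm))

variable [FiniteDimensional ℝ E]

/-- A solution of the Lagrangian equation at a point gives a solution at all the points of the fibre
of the Legendre transformation, with the same differential of the Legendre transformation. -/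
theorem exists_solution_of_fibreP_eq (hL : ContMDiff (IT E k) 𝓘(ℝ, ℝ) ∞ L)
    (hreg : IsAlmostRegular L) {q : Q} {v v' : (Fin k → ℝ) →L[ℝ] E}
    (h : fibreP L q v' = fibreP L q v) {Y : Fin k → E × ((Fin k → ℝ) →L[ℝ] E)}
    (hY : ∀ z, Omega L (inFibre q v) Y z = dFun (energy L) (inFibre q v) z) :
    ∃ Y' : Fin k → E × ((Fin k → ℝ) →L[ℝ] E), (∀ α, (Y' α).1 = (Y α).1) ∧
      ∀ z, Omega L (inFibre q v') Y' z = dFun (energy L) (inFibre q v') z := by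
  choose Y' h1 h2 using fun α => exists_same_dLegendre hL hreg h (Y α)
  refine ⟨Y', h1, fun z => ?_⟩
  -- The test vector is carried back to `v`, where the equation is known; both sides see only `TFL`
  -- of the vectors.
  obtain ⟨z₀, h3, h4⟩ := exists_same_dLegendre hL hreg h.symm z
  refine Eq.trans ?_ ((hY z₀).trans (dFun_energy_eq hL hreg h.symm h3 h4))
  refine (Omega_inFibre hL q v' Y' z).trans (Eq.trans ?_ (Omega_inFibre hL q v Y z₀).symm)
  refine Finset.sum_congr rfl fun α _ => ?_
  rw [h1, h2, h3, h4]

/-- The projection to the fibre of a point `x` of `P_1`: a point with the same momenta, whose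
components are the base components of the solutions at all the points of the fibre of `FL`
through `x`. -/
theorem exists_centre (hL : ContMDiff (IT E k) 𝓘(ℝ, ℝ) ∞ L)
    (hreg : IsAlmostRegular L) {q : Q} {v : (Fin k → ℝ) →L[ℝ] E}
    {Y : Fin k → E × ((Fin k → ℝ) →L[ℝ] E)}
    (hY : ∀ z, Omega L (inFibre q v) Y z = dFun (energy L) (inFibre q v) z) :
    ∃ u : (Fin k → ℝ) →L[ℝ] E, fibreP L q u = fibreP L q v ∧
      (∃ Y' : Fin k → E × ((Fin k → ℝ) →L[ℝ] E), (∀ α, (Y' α).1 = u (Pi.single α 1)) ∧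
        ∀ z, Omega L (inFibre q u) Y' z = dFun (energy L) (inFibre q u) z) ∧
      ∀ b w, fibreP L q b = fibreP L q v → dP L q b (0, w) = 0 →
        fibreP L q (b + w) = fibreP L q v := by
  set u : (Fin k → ℝ) →L[ℝ] E := ∑ α, single (E := E) α (Y α).1 with hu
  have hu1 : ∀ α, u (Pi.single α 1) = (Y α).1 := apply_sum_single _
  have hsub : ∀ b, fibreP L q b = fibreP L q v → fderiv ℝ (fibreP L q) b (u - b) = 0 := by
    intro b hb
    obtain ⟨Y', h1, h2⟩ := exists_solution_of_fibreP_eq hL hreg hb hY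
    exact fderiv_fibreP_sub_eq_zero hL h2 fun α => (hu1 α).trans (h1 α).symm
  have hr := hasRetractions_fibreP hL hreg q (fibreP L q v)
  have hum : fibreP L q u = fibreP L q v := by
    -- The ray at parameter `0` is its vertex `u`.
    simpa using ray_mem_level (contDiff_fibreP hL q) hr hsub rfl le_rfl
  refine ⟨u, hum, ?_, fun b w hb hw => ?_⟩
  · obtain ⟨Y', h1, h2⟩ := exists_solution_of_fibreP_eq hL hreg hum hY
    exact ⟨Y', fun α => (h1 α).trans (hu1 α).symm, h2⟩
  · refine add_mem_level (contDiff_fibreP hL q) hr hsub hb ?_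
    rw [fderiv_fibreP hL, hw]

theorem image_legendre_P1 (hL : ContMDiff (IT E k) 𝓘(ℝ, ℝ) ∞ L) (hreg : IsAlmostRegular L)
    (X : KVF E Q k) (hX : IsLagrangianOn L X (P1 L)) :
    legendre L '' P1 L = legendre L '' S1 L X := by
  refine Subset.antisymm ?_ (image_mono fun x hx => hx.1)
  rintro _ ⟨x, ⟨Y, hY⟩, rfl⟩
  obtain ⟨u, hu, ⟨Y', h1, h2⟩, -⟩ := exists_centre hL hreg (q := x.proj) (v := vel x) hY
  have hx : inFibre x.proj u ∈ P1 L := ⟨Y', h2⟩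
  obtain ⟨X₀, hX₀⟩ : ∃ X₀ : Fin k → E × ((Fin k → ℝ) →L[ℝ] E),
      X₀ = fun α => X α (inFibre x.proj u) := ⟨_, rfl⟩
  -- The correction is the difference of two solutions at the centre, hence in the kernel of `Ω_L`.
  -- It replaces `X` by `Y'`, whose base components are those of `u`.
  refine ⟨inFibre x.proj u, ⟨hx, fun α => Y' α - X₀ α, fun z => ?_, ?_⟩,
    legendre_eq_of_fibreP_eq hL hu⟩
  · refine (Omega_sub hL x.proj u Y' X₀ z).trans ?_
    rw [h2 z, hX₀]
    exact sub_eq_zero.2 (hX _ hx z).symm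
  · have h3 : ∀ α, J α (inFibre x.proj u)
        (X α (inFibre x.proj u) + (show TT (inFibre x.proj u) from Y' α - X₀ α)) =
        ((0, single α (u (Pi.single α 1))) : E × ((Fin k → ℝ) →L[ℝ] E)) := by
      intro α
      refine (J_inFibre α x.proj u _).trans ?_
      have h5 : X₀ α + (Y' α - X₀ α) = Y' α := add_sub_cancel _ _
      rw [← h1 α]
      refine congrArg (fun y : E × ((Fin k → ℝ) →L[ℝ] E) => (0, single α y.1)) (Eq.trans ?_ h5)
      rw [hX₀]
      rfl
    refine (Finset.sum_congr rfl fun α _ => h3 α).trans ?_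
    refine Eq.trans ?_ ((liouville_eq_vertical (inFibre x.proj u)).trans
      (vertical_inFibre x.proj u u)).symm
    have h4 := map_sum (ContinuousLinearMap.inr ℝ E ((Fin k → ℝ) →L[ℝ] E))
      (fun α => single (E := E) α (u (Pi.single α 1))) Finset.univ
    rw [sum_single] at h4
    exact h4.symm

theorem not_isProjectableOn_eta [T2Space Q] (hL : ContMDiff (IT E k) 𝓘(ℝ, ℝ) ∞ L)
    (hreg : IsAlmostRegular L) {X : KVF E Q k} (hX : IsLagrangianOn L X (P1 L))
    {Γ : KVF E Q k} (hΓ : IsSOPDE Γ) {Z : VF E Q k} (hZ : Z ∈ frakM L)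
    (h : ∃ x ∈ P1 L, eta L Γ X Z x ≠ 0) : ¬ IsProjectableOn L (P1 L) (eta L Γ X Z) := by
  rintro ⟨g, hg⟩
  obtain ⟨x, hx, hne⟩ := h
  obtain ⟨Y, hY⟩ := id hx
  obtain ⟨u, hu, ⟨Y', h1, h2⟩, -⟩ := exists_centre hL hreg (q := x.proj) (v := vel x) hY
  have hx' : inFibre x.proj u ∈ P1 L := ⟨Y', h2⟩
  apply hne
  rw [hg x hx, ← legendre_eq_of_fibreP_eq hL hu, ← hg _ hx', eta_inFibre hL hX Γ Z hx',
    ← h2, sub_eq_zero]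
  -- At the centre `Γ` and the solution `Y'` have the same base components, so the constraint
  -- vanishes there.
  exact Omega_eq_of_vertical hL x.proj u (fun α => Γ α (inFibre x.proj u)) Y'
    (fun α => (fst_of_isSOPDE hΓ α x.proj u).trans (h1 α).symm)
    (Omega_eq_zero_of_mem_frakM hZ x.proj u)

/-- A functional vanishing on the kernel of the Hessian is represented by some `c` through the
Hessian. Subtracting the vertical vector `(0, c)` from `z` then leaves a vector in all the kernels
of the `ω^α_L`. -/
theorem mem_kerPlusVertical_of_linPart (hL : ContMDiff (IT E k) 𝓘(ℝ, ℝ) ∞ L) {q : Q}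
    {v : (Fin k → ℝ) →L[ℝ] E} {z : E × ((Fin k → ℝ) →L[ℝ] E)}
    (hz : ∀ c α, dP L q v (0, c) z.1 α = 0)
    (h : ∀ w, dP L q v (0, w) = 0 → linPart L q v z w = 0) :
    z ∈ kerPlusVertical L (inFibre q v) := by
  have hadd : ∀ D : E × ((Fin k → ℝ) →L[ℝ] E) →L[ℝ] E →L[ℝ] (Fin k → ℝ), ∀ c d,
      D (0, c + d) = D (0, c) + D (0, d) := by
    intro D c d
    rw [← map_add]
    simp
  have hsmul : ∀ D : E × ((Fin k → ℝ) →L[ℝ] E) →L[ℝ] E →L[ℝ] (Fin k → ℝ), ∀ (t : ℝ) c,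
      D (0, t • c) = t • D (0, c) := by
    intro D t c
    rw [← map_smul]
    simp
  obtain ⟨c, hc⟩ := mem_range_of_forall_eq_zero
    (LinearMap.mk₂ ℝ (fun c w => pair (dP L q v (0, c)) w)
      (fun c d w => by simp [pair, hadd, Finset.sum_add_distrib])
      (fun t c w => by simp [pair, hsmul, Finset.mul_sum])
      (fun c w w' => pair_add_right _ w w') (fun t c w => pair_smul_right _ t w))
    { toFun := linPart L q v z, map_add' := linPart_add q v z, map_smul' := linPart_smul q v z }
    (fun w hw => h w ((dP_eq_zero_iff hL q v w).2 hw))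
  have hc' : ∀ w, pair (dP L q v (0, c)) w = linPart L q v z w := fun w => DFunLike.congr_fun hc w
  refine ⟨(z - (0, c) : E × ((Fin k → ℝ) →L[ℝ] E)), ((0, c) : E × ((Fin k → ℝ) →L[ℝ] E)),
    fun Y => ?_, dProj_inFibre q v _, (sub_add_cancel z _).symm⟩
  obtain ⟨Y₀, hY₀⟩ : ∃ Y₀ : Fin k → E × ((Fin k → ℝ) →L[ℝ] E), Y₀ = Y := ⟨Y, rfl⟩
  subst hY₀
  refine (Omega_inFibre hL q v Y₀ _).trans ?_
  have h1 := hc' (∑ α, single (E := E) α (Y₀ α).1)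
  have h2 : ∀ α, dP L q v (Y₀ α) z.1 α = dP L q v ((Y₀ α).1, 0) z.1 α := by
    intro α
    have h3 : Y₀ α = ((Y₀ α).1, 0) + (0, (Y₀ α).2) := by simp
    conv_lhs => rw [h3, map_add]
    rw [add_apply, Pi.add_apply, hz, add_zero]
  simp only [linPart, pair, apply_sum_single] at h1
  simp only [map_sub, Prod.fst_sub, sub_zero, sub_apply, Pi.sub_apply, h2,
    Finset.sum_sub_distrib, h1]
  ring

theorem Omega_SOPDE_eq_linPart (hL : ContMDiff (IT E k) 𝓘(ℝ, ℝ) ∞ L)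
    (hreg : IsAlmostRegular L) {q : Q} {v b : (Fin k → ℝ) →L[ℝ] E}
    (hb : fibreP L q b = fibreP L q v) {z z' : E × ((Fin k → ℝ) →L[ℝ] E)} (h1 : z'.1 = z.1)
    (h2 : dP L q b z' = dP L q v z) (hz : ∀ c α, dP L q v (0, c) z.1 α = 0)
    {G : Fin k → E × ((Fin k → ℝ) →L[ℝ] E)} (hG : ∀ α, (G α).1 = b (Pi.single α 1)) :
    Omega L (inFibre q b) G z' = linPart L q v z b := by
  refine (Omega_inFibre hL q b G z').trans ?_
  rw [linPart, pair, ← Finset.sum_sub_distrib]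
  refine Finset.sum_congr rfl fun α _ => ?_
  rw [h2, hG]
  congr 1
  -- `G α` is replaced by a vector at `v` with the same image by `TFL`. Its unknown vertical part
  -- does not contribute, by `hz`, so only the velocity of `b` remains and the result is linear in
  -- `b`.
  obtain ⟨u', h3, h4⟩ := exists_same_dLegendre hL hreg hb.symm (G α)
  have h5 : u' = (b (Pi.single α 1), 0) + (0, u'.2) := Prod.ext (by simp [h3, hG]) (by simp)
  rw [← h4, h1, h5, map_add, add_apply, Pi.add_apply, hz, add_zero]

/-- If `Z` is projectable and not vertical up to `⋂_α ker ω^α_L`, then `η^(Z)` is affine and not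
constant along some line in the fibre of `FL`. -/
theorem exists_line_eta [T2Space Q] (hL : ContMDiff (IT E k) 𝓘(ℝ, ℝ) ∞ L)
    (hreg : IsAlmostRegular L) {X : KVF E Q k} (hX : IsLagrangianOn L X (P1 L))
    {Γ : KVF E Q k} (hΓ : IsSOPDE Γ) {Z : VF E Q k} (hZ : Z ∈ frakM L)
    (hZp : IsProjectableVF L Z) {q : Q} {v : (Fin k → ℝ) →L[ℝ] E} (hv : inFibre q v ∈ P1 L)
    (hker : Z (inFibre q v) ∉ kerPlusVertical L (inFibre q v)) :
    ∃ w : (Fin k → ℝ) →L[ℝ] E, dP L q v (0, w) = 0 ∧ ∃ c : ℝ, c ≠ 0 ∧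
      ∀ t : ℝ, inFibre q (v + t • w) ∈ P1 L ∧
        eta L Γ X Z (inFibre q (v + t • w)) = eta L Γ X Z (inFibre q v) + t * c := by
  have hz := dP_vertical_eq_zero hL (Omega_eq_zero_of_mem_frakM hZ q v)
  obtain ⟨w, hw, hne⟩ : ∃ w, dP L q v (0, w) = 0 ∧ linPart L q v (Z (inFibre q v)) w ≠ 0 := by
    by_contra! h
    exact hker (mem_kerPlusVertical_of_linPart hL hz h)
  obtain ⟨Y, hY⟩ := id hv
  obtain ⟨-, -, -, hadd⟩ := exists_centre hL hreg hY
  have hfib : ∀ t : ℝ, fibreP L q (v + t • w) = fibreP L q v := by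
    have hsmul : ∀ (D : E × ((Fin k → ℝ) →L[ℝ] E) →L[ℝ] E →L[ℝ] (Fin k → ℝ)) (t : ℝ),
        D (0, w) = 0 → D (0, t • w) = 0 := by
      intro D t h
      rw [← smul_zero t, ← Prod.smul_mk, map_smul, h, smul_zero]
    exact fun t => hadd v _ rfl (hsmul _ t hw)
  have hP1 : ∀ b, fibreP L q b = fibreP L q v → inFibre q b ∈ P1 L := by
    intro b hb
    obtain ⟨Y', -, h⟩ := exists_solution_of_fibreP_eq hL hreg hb hY
    exact ⟨Y', h⟩
  have heta : ∀ b, fibreP L q b = fibreP L q v → eta L Γ X Z (inFibre q b) =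
      linPart L q v (Z (inFibre q v)) b -
        dFun (energy L) (inFibre q v) (Z (inFibre q v)) := by
    intro b hb
    obtain ⟨h1, h2⟩ := same_dLegendre_of_isProjectableVF hL hZp hb
    have h3 := Omega_SOPDE_eq_linPart hL hreg hb h1 h2 hz
      (G := fun α => Γ α (inFibre q b)) fun α => fst_of_isSOPDE hΓ α q b
    have h4 := dFun_energy_eq hL hreg hb h1 h2
    exact (eta_inFibre hL hX Γ Z (hP1 b hb)).trans (congrArg₂ (· - ·) h3 h4)
  refine ⟨w, hw, _, hne, fun t => ⟨hP1 _ (hfib t), ?_⟩⟩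
  have h1 : linPart L q v (Z (inFibre q v)) (v + t • w) =
      linPart L q v (Z (inFibre q v)) v + t * linPart L q v (Z (inFibre q v)) w :=
    (linPart_add q v _ v _).trans (congrArg _ (linPart_smul q v _ t w))
  linarith [heta _ (hfib t), heta v rfl]

end Constraints

end KSymplectic

end

theorem mainTheorem5 {E : Type*} [NormedAddCommGroup E] [NormedSpace ℝ E] [FiniteDimensional ℝ E]
    {Q : Type*} [TopologicalSpace Q] [T2Space Q] [SecondCountableTopology Q]
    [ChartedSpace E Q] [IsManifold 𝓘(ℝ, E) ∞ Q] {k : ℕ}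
    (L : KSymplectic.TkQ E Q k → ℝ)
    (hL : ContMDiff (KSymplectic.IT E k) 𝓘(ℝ, ℝ) ∞ L)
    (hreg : KSymplectic.IsAlmostRegular L)
    (X : KSymplectic.KVF E Q k)
    (hX : KSymplectic.IsLagrangianOn L X (KSymplectic.P1 L)) :
    (∀ Γ : KSymplectic.KVF E Q k, KSymplectic.IsSOPDE Γ →
      ∀ Z ∈ KSymplectic.frakM L \ KSymplectic.annihilator L (KSymplectic.smoothKVF E Q k),
        ((∃ x ∈ KSymplectic.P1 L, KSymplectic.eta L Γ X Z x ≠ 0) →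
          ¬ KSymplectic.IsProjectableOn L (KSymplectic.P1 L) (KSymplectic.eta L Γ X Z)) ∧
        (KSymplectic.IsProjectableVF L Z →
          ∀ x ∈ KSymplectic.P1 L, Z x ∉ KSymplectic.kerPlusVertical L x →
            (∃ w : (Fin k → ℝ) →L[ℝ] E,
              KSymplectic.dLegendre L x (KSymplectic.vertical x w) = 0 ∧
              ∃ c : ℝ, c ≠ 0 ∧
                HasDerivAt (fun t : ℝ => KSymplectic.eta L Γ X Z
                  (KSymplectic.inFibre x.proj (KSymplectic.vel x + t • w))) c 0) ∧
            ¬ KSymplectic.IsProjectableOn L (KSymplectic.P1 L) (KSymplectic.eta L Γ X Z))) ∧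
    KSymplectic.legendre L '' KSymplectic.P1 L = KSymplectic.legendre L '' KSymplectic.S1 L X := by
  
  refine ⟨fun Γ hΓ Z hZ => ⟨KSymplectic.not_isProjectableOn_eta hL hreg hX hΓ hZ.1, ?_⟩,
    KSymplectic.image_legendre_P1 hL hreg X hX⟩
  intro hZp x hx hker
  obtain ⟨w, hw, c, hc, hline⟩ :=
    KSymplectic.exists_line_eta hL hreg hX hΓ hZ.1 hZp (q := x.proj) (v := KSymplectic.vel x) hx hker
  refine ⟨⟨w, ?_, c, hc, ?_⟩, KSymplectic.not_isProjectableOn_eta hL hreg hX hΓ hZ.1 ?_⟩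
  · refine (congrArg (KSymplectic.dLegendre L x)
      (KSymplectic.vertical_inFibre x.proj (KSymplectic.vel x) w)).trans ?_
    exact (KSymplectic.dLegendre_inFibre hL x.proj (KSymplectic.vel x) (0, w)).trans
      (Prod.ext rfl hw)
  · have h : HasDerivAt (fun t : ℝ => KSymplectic.eta L Γ X Z x + t * c) c 0 := by
      simpa using ((hasDerivAt_id (0 : ℝ)).mul_const c).const_add (KSymplectic.eta L Γ X Z x)
    exact h.congr_of_eventuallyEq (Filter.Eventually.of_forall fun t => (hline t).2)
  -- Item 1 needs only one point where the constraint is nonzero: its values at `t = 0` and `t = 1`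
  -- on the line differ by `c`.
  · by_contra! h
    have h1 := (hline 1).2
    rw [h _ (hline 1).1, one_mul] at h1
    have h2 : KSymplectic.eta L Γ X Z (KSymplectic.inFibre x.proj (KSymplectic.vel x)) = 0 := h x hx
    exact hc (by linarith)
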